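/- Let $\mathcal L=\{R,G,X,Y\}$ consist of four binary, symmetric, irreflexive relation symbols. An $\mathcal L$-structure is complete if any two distinct elements $a,b$ are related by exactly one relation, denoted $\mathbf r(a,b)$. Let $$S=\{RRX,\ RXX,\ RYY,\ GYX,\ GXX,\ YYX,\ XXX\}$$ (a triangle, i.e. a complete structure on three points, is given by its three colours), and let $\mathrm{Forb}_c(S)$ be the class of finite complete $\mathcal L$-structures that embed no triangle from $S$. Order $\mathcal L'=\{R,G,Y\}\subsetneq\mathcal L$ as $R_1>R_2>R_3$ with $R_1=G$, $R_2=R$, $R_3=Y$. For $A,B,C\in\mathrm{Forb}_c(S)$ with $B\subseteq A,C$, let $A\otimes_B C$ be the structure on the disjoint union of $A$ and $C$ over $B$ that extends $A$ and $C$ and in which, for $a\in A\setminus B$ and $c\in C\setminus B$, $\mathbf r(a,c)=R_i$ for the least $i$ such that $\mathbf r(a,b)\,\mathbf r(b,c)\,R_i\notin S$ for all $b\in B$. (1) $\mathrm{Forb}_c(S)$ is a prioritised semi-free amalgamation class with respect to $G>R>Y$: it is an amalgamation class, and $A\otimes_B C$ is well defined and belongs to $\mathrm{Forb}_c(S)$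 for all $A,B,C\in \mathrm{Forb}_c(S)$ with $B\subseteq A,C$. In particular it has a Fraïssé limit. Let $\mathcal M_S$ be the (countable, homogeneous) Fraïssé limit of $\mathrm{Forb}_c(S)$. For finite $A,B,C\subseteq\mathcal M_S$ write $A\perp_B C$ if the substructure $ABC$ (on $A\cup B\cup C$) is $AB\otimes_B BC$. Types over $B$ are orbits of tuples under the pointwise stabiliser of $B$ in $\mathrm{Aut}(\mathcal M_S)$. Then: (2) $\perp$ is a stationary independence relation on $\mathcal M_S$, i.e. it satisfies, for finite sets, invariance under $\mathrm{Aut}(\mathcal M_S)$; monotonicity ($A\perp_B CD$ implies $A\perp_B C$ and $A\perp_{BC}D$); transitivity ($A\perp_B C$ and $A\perp_{BC}D$ imply $A\perp_B D$); symmetry; existence (every $n$-type over $B$ has a realisation $a$ with $a\perp_B C$); and stationarity (if $a,a'$ are $n$-tuples with the same type over $B$, both independent from $C$ over $B$, then they have the same type over $BC$). (3) The following condition fails in $\mathcal M_S$: for all $a,b,c\in\mathcal M_S$ and finite $B\subseteq \mathcal M_S$, if $a\perp_{bB}c$ and $\mathbf r(a,b)\in\mathcal L'$, then $a\perp_B c$.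 (4) Nevertheless, for every non-trivial $g\in\mathrm{Aut}(\mathcal M_S)$ there are $k,h\in\mathrm{Aut}(\mathcal M_S)$ such that $[k,[h,g]]$ moves almost maximally, where $[h,g]=h^{-1}g^{-1}hg$, and $f\in \mathrm{Aut}(\mathcal M_S)$ moves almost maximally if every $1$-type over a finite set $Z$ has a realisation $a$ with $a\perp_Z f(a)$. (5) The group $\mathrm{Aut}(\mathcal M_S)$ is simple. -/

import Mathlib

universe u v

open FirstOrder FirstOrder.Language CategoryTheory

namespace ColouredTriangles

/-! ### The automorphism group of a first-order structure -/

section AutomorphismGroup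

variable {L : FirstOrder.Language.{v, v}} {M : Type u} [L.Structure M]

/-- The automorphism group `Aut(M)`; the product is composition, `(g * h) a = g (h a)`. -/
instance autGroup : Group (M ≃[L] M) where
  mul g h := g.comp h
  one := FirstOrder.Language.Equiv.refl L M
  inv g := g.symm
  mul_assoc _ _ _ := rfl
  one_mul _ := rfl
  mul_one _ := rfl
  inv_mul_cancel g := by
    apply FirstOrder.Language.Equiv.ext
    intro a
    exact g.symm_apply_apply a

/-- The commutator `[h, g] = h⁻¹ g⁻¹ h g`. -/
def groupCommutator {G : Type*} [Group G] (h g : G) : G := h⁻¹ * g⁻¹ * h * g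

/-- Two tuples have the same type over `B`: they lie in the same orbit of the pointwise
stabiliser of `B` in `Aut(M)`. -/
def SameType (L : FirstOrder.Language.{v, v}) {M : Type u} [L.Structure M] (B : Set M) {n : ℕ}
    (a a' : Fin n → M) : Prop :=
  ∃ σ : M ≃[L] M, (∀ b ∈ B, σ b = b) ∧ ∀ i, σ (a i) = a' i

/-- Stationary independence relations on the finite subsets of `M`.
`Ind A B C` is read: `A` is independent from `C` over `B`. -/
structure IsStationaryIndependence (L : FirstOrder.Language.{v, v}) {M : Type u} [L.Structure M]
    (Ind : Set M → Set M → Set M → Prop) : Prop where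
  invariance : ∀ (g : M ≃[L] M) (A B C : Set M), A.Finite → B.Finite → C.Finite →
    Ind A B C → Ind (g '' A) (g '' B) (g '' C)
  monotonicity : ∀ A B C D : Set M, A.Finite → B.Finite → C.Finite → D.Finite →
    Ind A B (C ∪ D) → Ind A B C ∧ Ind A (B ∪ C) D
  transitivity : ∀ A B C D : Set M, A.Finite → B.Finite → C.Finite → D.Finite →
    Ind A B C → Ind A (B ∪ C) D → Ind A B D
  symmetry : ∀ A B C : Set M, A.Finite → B.Finite → C.Finite → Ind A B C → Ind C B A
  existence : ∀ (n : ℕ) (p : Fin n → M) (B C : Set M), B.Finite → C.Finite →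
    ∃ a : Fin n → M, SameType L B p a ∧ Ind (Set.range a) B C
  stationarity : ∀ (n : ℕ) (a a' : Fin n → M) (B C : Set M), B.Finite → C.Finite →
    SameType L B a a' → Ind (Set.range a) B C → Ind (Set.range a') B C →
    SameType L (B ∪ C) a a'

/-- `g` moves almost maximally: every 1-type over a finite set `X` (given here by a realisation
`p`) has a realisation `a` that is independent from `g a` over `X`. -/
def MovesAlmostMaximally {L : FirstOrder.Language.{v, v}} {M : Type u} [L.Structure M]
    (Ind : Set M → Set M → Set M → Prop) (g : M ≃[L] M) : Prop :=
  ∀ (X : Set M) (p : M), X.Finite → ∃ a : M, SameType L X ![p] ![a] ∧ Ind {a} X {g a}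

end AutomorphismGroup

/-! ### Complete edge-coloured structures omitting triangles -/

/-- One binary relation symbol for every colour in `κ`, and no other symbols. -/
inductive ColourRel (κ : Type) : ℕ → Type
  | rel : κ → ColourRel κ 2

/-- The relational language with one binary relation symbol for every colour in `κ`. -/
def colourLang (κ : Type) : FirstOrder.Language.{0, 0} := ⟨fun _ => Empty, ColourRel κ⟩

instance colourLang_isRelational (κ : Type) : (colourLang κ).IsRelational :=
  fun _ => inferInstanceAs (IsEmpty Empty)

instance colourLang_countableFunctions (κ : Type) :
    Countable (Σ l, (colourLang κ).Functions l) :=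
  inferInstanceAs (Countable (Σ _ : ℕ, Empty))

/-- The pair `(a, b)` is related by the relation symbol `i`. In a complete structure, and for
`a ≠ b`, this says `r(a, b) = i`. -/
def HasColour {κ : Type} {M : Type u} [(colourLang κ).Structure M] (i : κ) (a b : M) : Prop :=
  Structure.RelMap (L := colourLang κ) (ColourRel.rel i) ![a, b]

/-- A complete structure: all relations are irreflexive and symmetric, and any two distinct
elements are related by exactly one of them. -/
structure IsComplete (κ : Type) (M : Type u) [(colourLang κ).Structure M] : Prop where
  irrefl : ∀ (i : κ) (a : M), ¬ HasColour i a a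
  symm : ∀ (i : κ) (a b : M), HasColour i a b → HasColour i b a
  exactly_one : ∀ a b : M, a ≠ b → ∃! i : κ, HasColour i a b

/-- No three distinct points span a triangle in `S`; a triangle is given, up to isomorphism, by
the multiset of its three colours. -/
def OmitsTriangles {κ : Type} (S : Set (Multiset κ)) (M : Type u)
    [(colourLang κ).Structure M] : Prop :=
  ∀ (a b c : M), a ≠ b → b ≠ c → a ≠ c → ∀ i j k : κ,
    HasColour i a b → HasColour j b c → HasColour k a c → ({i, j, k} : Multiset κ) ∉ S

/-- The class `Forb_c(S)` of all finite complete structures that embed no triangle from `S`. -/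
def Forb {κ : Type} (S : Set (Multiset κ)) : Set (Bundled.{u} (colourLang κ).Structure) :=
  {A | Finite A ∧ IsComplete κ A ∧ OmitsTriangles S A}

/-! ### Prioritised semi-free amalgamation -/

section Priority

variable {κ : Type} (S : Set (Multiset κ)) {m : ℕ} (R : Fin m → κ)

/-- Colouring `(a, c)` by `k` creates no triangle of `S` with a third vertex in `B`. -/
def Allowed {D : Type u} [(colourLang κ).Structure D] (B : Set D) (a c : D) (k : κ) : Prop :=
  ∀ b ∈ B, ∀ i j : κ, HasColour i a b → HasColour j b c → ({i, j, k} : Multiset κ) ∉ S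

/-- Inside `D`, the substructure on `A ∪ C` is the prioritised amalgam `A ⊗_B C` with respect to
`R 0 > R 1 > ⋯`: the sets `A` and `C` meet exactly in `B`, and for `a ∈ A \ B`, `c ∈ C \ B` the
colour of `(a, c)` is `R i` for the least `i` such that `R i` is allowed over `B`. -/
def IsPrioritisedAmalgam {D : Type u} [(colourLang κ).Structure D] (A B C : Set D) : Prop :=
  B ⊆ A ∧ B ⊆ C ∧ A ∩ C = B ∧
    ∀ a ∈ A \ B, ∀ c ∈ C \ B, ∃ i : Fin m,
      Allowed S B a c (R i) ∧ (∀ j < i, ¬ Allowed S B a c (R j)) ∧ HasColour (R i) a c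

/-- `Forb_c(S)` is a prioritised semi-free amalgamation class with respect to the proper subset
`{R 0, R 1, …}` of the language, ordered as `R 0 > R 1 > ⋯`: it is an amalgamation class, and
`A ⊗_B C` belongs to it for all `A`, `B`, `C` in it and all embeddings of `B` in `A` and `C`. -/
structure IsPrioritisedSemiFree : Prop where
  injective : Function.Injective R
  proper : Set.range R ⊂ Set.univ
  isFraisse : IsFraisse (Forb.{u} S)
  amalgam_mem : ∀ (A B C : Bundled.{u} (colourLang κ).Structure),
    A ∈ Forb S → B ∈ Forb S → C ∈ Forb S →
    ∀ (f₁ : B ↪[colourLang κ] A) (f₂ : B ↪[colourLang κ] C),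
      ∃ D ∈ Forb.{u} S, ∃ (g₁ : A ↪[colourLang κ] D) (g₂ : C ↪[colourLang κ] D),
        (∀ b, g₁ (f₁ b) = g₂ (f₂ b)) ∧ Set.range g₁ ∪ Set.range g₂ = Set.univ ∧
        IsPrioritisedAmalgam S R (Set.range g₁) (Set.range fun b => g₁ (f₁ b)) (Set.range g₂)

/-- `A` is independent from `C` over `B`: `ABC = AB ⊗_B BC`. -/
def Indep {M : Type u} [(colourLang κ).Structure M] (A B C : Set M) : Prop :=
  IsPrioritisedAmalgam S R (A ∪ B) B (B ∪ C)

/-- If `a` is independent from `c` over `bB` and `r(a, b)` is one of the colours `R i`, then `a`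
is independent from `c` over `B`. -/
def BaseReduction (M : Type u) [(colourLang κ).Structure M] : Prop :=
  ∀ (a b c : M) (B : Set M), B.Finite → (∃ i, HasColour (R i) a b) →
    Indep S R {a} (insert b B) {c} → Indep S R {a} B {c}

end Priority

/-! ### The case under consideration -/

/-- The four colours. -/
inductive Colour : Type
  | R | G | X | Y

open Colour in
/-- The forbidden triangles `RRX, RXX, RYY, GYX, GXX, YYX, XXX`. -/
def S26 : Set (Multiset Colour) :=
  {{R, R, X}, {R, X, X}, {R, Y, Y}, {G, Y, X}, {G, X, X}, {Y, Y, X}, {X, X, X}}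

/-- The colours `G > R > Y`. -/
def order26 : Fin 3 → Colour := ![Colour.G, Colour.R, Colour.Y]

/-- The language `{R, G, X, Y}`. -/
abbrev L26 : FirstOrder.Language.{0, 0} := colourLang Colour

end ColouredTriangles

open ColouredTriangles

/-! Equality is treated as a fifth colour E. A base point `b` excludes G from a pair `(a, c)` only
if its two colours are XX, where `S` leaves nothing but Y, or XY, where G and Y are forbidden and R
is the best choice left. So the amalgam is governed by a partial operation `comp` with XX ↦ Y, XY ↦
R and E as identity, the default being G. Facts about independence then become statements about
finitely many colour patterns, settled by `decide`. `freeValue_tri` shows that the free one-point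
extension omits `S`; `ind_mono`, `ind_trans` and `d_eq_of_ind` give monotonicity, transitivity and
stationarity. One-point amalgamation also yields a countable structure realising all consistent
one-point types over finite sets. It is a Fraïssé limit, and uniqueness carries the calculus to
every other limit.

Base reduction fails because Y followed by X forces R. But a forced value between distinct points
always involves X, so a base point may be dropped when both of its colours lie in `L'`
(`ind_of_insert`). This weaker rule suffices if commutators are taken twice. For generic `h` and `k
= [h,g]`, the point `k a` is independent from `a` over `g a` and a finite set, and the pair `(g a, k
a)` has the colour of some pair `(g w, w)`. A non-trivial `g` moves a realisation of every
non-trivial type, so the first commutator has pairs `(a, k a)` with colours in `L'`. For the second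
commutator both steps `a`, `g a`, `k a` have such colours; the middle point drops out, and the new
commutator moves maximally.

If `g` moves maximally, the values of a conjugate of `g` on a finite set can be prescribed as long
as they are generic (`MovesMaximally.exists_conj_eqOn`). Routing a finite partial automorphism
through two generic intermediate sets shows that products of three conjugates are dense in some open
set, inside any prescribed neighbourhood of the conjugating triple
(`MovesMaximally.exists_denseNear`). A back-and-forth between this family and its translate by `f`,
in effect a Baire category argument, produces triples `a`, `b` with `conjProd g a = f * conjProd g
b`. Hence `f` lies in the normal closure of `g`. -/

namespace ColouredTriangles

universe w

/-! ### The algebra of colours -/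

/-- The four colours together with the colour `E` of the pairs `(a, a)`. -/
inductive Hue : Type
  | E | R | G | X | Y
  deriving DecidableEq

instance : Fintype Hue :=
  ⟨{Hue.E, Hue.R, Hue.G, Hue.X, Hue.Y}, fun i => by cases i <;> decide⟩

namespace Hue

/-- The triangles that may occur: `E` behaves as an identity, and no triangle of `S26` occurs. -/
def tri : Hue → Hue → Hue → Bool
  | E, j, k => decide (k = j)
  | i, E, k => decide (k = i)
  | R, R, k => decide (k ≠ X)
  | G, G, _ => true
  | Y, Y, k => decide (k ≠ R ∧ k ≠ X)
  | X, X, k => decide (k = Y ∨ k = E)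
  | R, X, k => decide (k = G ∨ k = Y)
  | X, R, k => decide (k = G ∨ k = Y)
  | R, Y, k => decide (k ≠ Y ∧ k ≠ E)
  | Y, R, k => decide (k ≠ Y ∧ k ≠ E)
  | R, G, k => decide (k ≠ E)
  | G, R, k => decide (k ≠ E)
  | G, Y, k => decide (k ≠ X ∧ k ≠ E)
  | Y, G, k => decide (k ≠ X ∧ k ≠ E)
  | G, X, k => decide (k = R ∨ k = G)
  | X, G, k => decide (k = R ∨ k = G)
  | Y, X, k => decide (k = R ∨ k = X)
  | X, Y, k => decide (k = R ∨ k = X)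

/-- The value that a point `b` with `r(a, b) = i` and `r(b, c) = j` imposes on an independent
pair `(a, c)`, if any. -/
def comp : Hue → Hue → Option Hue
  | E, j => some j
  | i, E => some i
  | X, X => some Y
  | X, Y => some R
  | Y, X => some R
  | _, _ => none

/-- The colours used by the prioritised amalgamation. -/
def Solution (i : Hue) : Prop := i = R ∨ i = G ∨ i = Y

instance : DecidablePred Solution := fun i => inferInstanceAs (Decidable (i = R ∨ i = G ∨ i = Y))

theorem tri_rotate : ∀ {i j k : Hue}, tri i j k → tri k j i := by decide

theorem tri_self_self : ∀ i : Hue, tri i i E := by decide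

theorem tri_swap_right : ∀ {i j k : Hue}, tri i j k → tri i k j := by decide

theorem tri_turn : ∀ {i j k : Hue}, tri i j k → tri j k i := by decide

theorem tri_rfl_left : ∀ i j : Hue, tri E i j ↔ j = i := by decide

theorem tri_eq_mid : ∀ i : Hue, tri i E i := by decide

theorem comp_comm : ∀ i j : Hue, comp i j = comp j i := by decide

theorem comp_eq_left : ∀ i : Hue, comp E i = some i := by decide

theorem eq_of_comp_eq : ∀ {i j : Hue}, comp i j = some E → i = E ∧ j = E := by decide

theorem solution_of_comp : ∀ {i j u : Hue}, comp i j = some u → i ≠ E → j ≠ E → Solution u := by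
  decide

theorem comp_eq_none : ∀ {i j : Hue}, Solution i → Solution j → comp i j = none := by decide

end Hue

open Hue

section Triangles

variable {M : Type w}

/-- On the set `S` the function `d` gives the colours of a complete structure without triangles
from `S26`. -/
structure TriOn (d : M → M → Hue) (S : Set M) : Prop where
  eq_iff : ∀ a ∈ S, ∀ b ∈ S, d a b = E ↔ a = b
  symm : ∀ a ∈ S, ∀ b ∈ S, d a b = d b a
  tri : ∀ a ∈ S, ∀ b ∈ S, ∀ c ∈ S, tri (d a b) (d b c) (d a c)

open Classical in
/-- The colours over all points of the independent extension of the one-point type `p` over `B`. -/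
noncomputable def freeValue (d : M → M → Hue) (B : Set M) (p : M → Hue) (c : M) : Hue :=
  if c ∈ B then p c
  else if ∃ b ∈ B, p b = X ∧ d b c = X then Y
  else if ∃ b ∈ B, p b = X ∧ d b c = Y ∨ p b = Y ∧ d b c = X then R
  else G

theorem freeValue_cases (d : M → M → Hue) (B : Set M) (p : M → Hue) (c : M) :
    (c ∈ B ∧ freeValue d B p c = p c) ∨
    (c ∉ B ∧ freeValue d B p c = Y ∧ ∃ b ∈ B, p b = X ∧ d b c = X) ∨
    (c ∉ B ∧ freeValue d B p c = R ∧ (∀ b ∈ B, p b = X → d b c ≠ X) ∧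
      ∃ b ∈ B, p b = X ∧ d b c = Y ∨ p b = Y ∧ d b c = X) ∨
    (c ∉ B ∧ freeValue d B p c = G ∧ (∀ b ∈ B, p b = X → d b c ≠ X) ∧
      (∀ b ∈ B, p b = X → d b c ≠ Y) ∧ ∀ b ∈ B, p b = Y → d b c ≠ X) := by
  unfold freeValue
  split_ifs with h1 h2 h3
  · exact Or.inl ⟨h1, rfl⟩
  · exact Or.inr (Or.inl ⟨h1, rfl, h2⟩)
  · refine Or.inr (Or.inr (Or.inl ⟨h1, rfl, fun b hb h h' => h2 ⟨b, hb, h, h'⟩, h3⟩))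
  · exact Or.inr (Or.inr (Or.inr ⟨h1, rfl, fun b hb h h' => h2 ⟨b, hb, h, h'⟩,
      fun b hb h h' => h3 ⟨b, hb, Or.inl ⟨h, h'⟩⟩, fun b hb h h' => h3 ⟨b, hb, Or.inr ⟨h, h'⟩⟩⟩))

theorem freeValue_ne_eq (d : M → M → Hue) {B : Set M} {p : M → Hue} (hp : ∀ b ∈ B, p b ≠ E)
    (c : M) : freeValue d B p c ≠ E := by
  rcases freeValue_cases d B p c with ⟨h, e⟩ | ⟨-, e, -⟩ | ⟨-, e, -⟩ | ⟨-, e, -⟩ <;> rw [e]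
  · exact hp c h
  all_goals decide

/-- One-point amalgamation. A value Y or R outside `B` has a witness in `B`, and lower priority
means that stronger witnesses are absent; the triangles through the witnesses leave only harmless
patterns. The pairs of values GG and RG need no witness, since no triangle of `S` contains them. -/
theorem freeValue_tri {d : M → M → Hue} {S B : Set M} {p : M → Hue} (hd : TriOn d S) (hB : B ⊆ S)
    (hp : ∀ b ∈ B, p b ≠ E) (ht : ∀ b ∈ B, ∀ b' ∈ B, tri (p b) (d b b') (p b')) :
    ∀ c ∈ S, ∀ c' ∈ S, tri (freeValue d B p c) (d c c') (freeValue d B p c') := by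
  -- the mixed cases, up to symmetry
  have key : ∀ c ∈ S, ∀ c' ∈ S, c ≠ c' →
      (c ∈ B → tri (freeValue d B p c) (d c c') (freeValue d B p c')) ∧
      (freeValue d B p c = Y → c ∉ B → c' ∉ B →
        tri (freeValue d B p c) (d c c') (freeValue d B p c')) ∧
      (freeValue d B p c = R → freeValue d B p c' ≠ Y → c ∉ B → c' ∉ B →
        tri (freeValue d B p c) (d c c') (freeValue d B p c')) := by
    intro c hc c' hc' hne
    have he : d c c' ≠ E := fun h => hne ((hd.eq_iff c hc c' hc').1 h)
    refine ⟨fun hcB => ?_, fun hv hcB hcB' => ?_, fun hv hv' hcB hcB' => ?_⟩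
    · have e1 : freeValue d B p c = p c := by simp [freeValue, hcB]
      rw [e1]
      rcases freeValue_cases d B p c' with ⟨h, e⟩ | ⟨-, e, b, hb, h1, h2⟩ | ⟨-, e, h0, b, hb, h1⟩ |
        ⟨-, e, h0, h1, h2⟩ <;> rw [e]
      · exact ht c hcB c' h
      · have t1 := ht b hb c hcB
        have t2 := hd.tri b (hB hb) c hc c' hc'
        rw [h1] at t1; rw [h2] at t2
        have := hp c hcB
        revert t1 t2 this he
        generalize d b c = i, d c c' = j, p c = k
        revert i j k; decide
      · have t1 := ht b hb c hcB
        have t2 := hd.tri b (hB hb) c hc c' hc'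
        have t3 := h0 c hcB
        have := hp c hcB
        rcases h1 with ⟨h1, h2⟩ | ⟨h1, h2⟩ <;> rw [h1] at t1 <;> rw [h2] at t2 <;>
        · revert t1 t2 t3 this he
          generalize d b c = i, d c c' = j, p c = k
          revert i j k; decide
      · have t0 := h0 c hcB
        have t1 := h1 c hcB
        have t2 := h2 c hcB
        have := hp c hcB
        revert t0 t1 t2 this he
        generalize d c c' = j, p c = k
        revert j k; decide
    · rcases freeValue_cases d B p c with ⟨h, -⟩ | ⟨-, e, b, hb, h1, h2⟩ | ⟨-, e, -⟩ | ⟨-, e, -⟩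
      · exact absurd h hcB
      · rw [hv]
        have t2 := hd.tri b (hB hb) c hc c' hc'
        rcases freeValue_cases d B p c' with ⟨h, -⟩ | ⟨-, e', b', hb', h1', h2'⟩ |
          ⟨-, e', h0', b', hb', h1'⟩ | ⟨-, e', h0', h1', h2'⟩
        · exact absurd h hcB'
        · rw [e']
          have t1 := ht b hb b' hb'
          have t3 := hd.tri b (hB hb) b' (hB hb') c' hc'
          rw [h2] at t2; rw [h1, h1'] at t1; rw [h2'] at t3
          revert t1 t2 t3 he
          generalize d b b' = i, d c c' = j, d b c' = k
          revert i j k; decide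
        · rw [e']
          have t1 := ht b hb b' hb'
          have t3 := hd.tri b (hB hb) b' (hB hb') c' hc'
          have t4 := h0' b hb h1
          rw [h2] at t2; rw [h1] at t1
          rcases h1' with ⟨h1', h2'⟩ | ⟨h1', h2'⟩ <;> rw [h1'] at t1 <;> rw [h2'] at t3 <;>
          · revert t1 t2 t3 t4 he
            generalize d b b' = i, d c c' = j, d b c' = k
            revert i j k; decide
        · rw [e']
          have t4 := h0' b hb h1
          have t5 := h1' b hb h1
          have t6 : d b c' ≠ E := fun h =>
            hcB' ((hd.eq_iff b (hB hb) c' hc').1 h ▸ hb)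
          rw [h2] at t2
          revert t2 t4 t5 t6 he
          generalize d c c' = j, d b c' = k
          revert j k; decide
      · rw [e] at hv; cases hv
      · rw [e] at hv; cases hv
    · rcases freeValue_cases d B p c with ⟨h, -⟩ | ⟨-, e, -⟩ | ⟨-, e, h0, b, hb, h1⟩ | ⟨-, e, -⟩
      · exact absurd h hcB
      · rw [e] at hv; cases hv
      · rw [hv]
        have t2 := hd.tri b (hB hb) c hc c' hc'
        rcases freeValue_cases d B p c' with ⟨h, -⟩ | ⟨-, e', -⟩ |
          ⟨-, e', h0', b', hb', h1'⟩ | ⟨-, e', h0', h1', h2'⟩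
        · exact absurd h hcB'
        · exact absurd e' hv'
        · rw [e']
          have t1 := ht b hb b' hb'
          have t3 := hd.tri b (hB hb) b' (hB hb') c' hc'
          have t4 := h0' b hb
          rcases h1 with ⟨h1, h2⟩ | ⟨h1, h2⟩ <;> rw [h1] at t1 t4 <;> rw [h2] at t2 <;>
          rcases h1' with ⟨h1', h2'⟩ | ⟨h1', h2'⟩ <;> rw [h1'] at t1 <;> rw [h2'] at t3 <;>
          · revert t1 t2 t3 t4 he
            generalize d b b' = i, d c c' = j, d b c' = k
            revert i j k; decide
        · rw [e']
          revert he
          generalize d c c' = j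
          revert j; decide
      · rw [e] at hv; cases hv
  intro c hc c' hc'
  by_cases hne : c = c'
  · subst hne
    rw [(hd.eq_iff c hc c hc).2 rfl]
    exact tri_eq_mid _
  obtain ⟨k1, k2, k3⟩ := key c hc c' hc' hne
  obtain ⟨k1', k2', k3'⟩ := key c' hc' c hc (Ne.symm hne)
  rw [hd.symm c' hc' c hc] at k1' k2' k3'
  by_cases hcB : c ∈ B
  · exact k1 hcB
  by_cases hcB' : c' ∈ B
  · exact tri_rotate (k1' hcB')
  by_cases hY : freeValue d B p c = Y
  · exact k2 hY hcB hcB'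
  by_cases hY' : freeValue d B p c' = Y
  · exact tri_rotate (k2' hY' hcB' hcB)
  by_cases hR : freeValue d B p c = R
  · exact k3 hR hY' hcB hcB'
  by_cases hR' : freeValue d B p c' = R
  · exact tri_rotate (k3' hR' hY hcB' hcB)
  have he : d c c' ≠ E := fun h => hne ((hd.eq_iff c hc c' hc').1 h)
  rcases freeValue_cases d B p c with ⟨h, -⟩ | ⟨-, e, -⟩ | ⟨-, e, -⟩ | ⟨-, e, -⟩
  · exact absurd h hcB
  · exact absurd e hY
  · exact absurd e hR
  rcases freeValue_cases d B p c' with ⟨h, -⟩ | ⟨-, e', -⟩ | ⟨-, e', -⟩ | ⟨-, e', -⟩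
  · exact absurd h hcB'
  · exact absurd e' hY'
  · exact absurd e' hR'
  rw [e, e']
  revert he
  generalize d c c' = j
  revert j; decide

end Triangles

/-! ### The independence calculus -/

/-- A complete structure without triangles from `S26`, given by its colour function. -/
class ColourSpace (M : Type w) where
  d : M → M → Hue
  triOn : TriOn d Set.univ

open ColouredTriangles.ColourSpace (d)

section Calculus

variable {M : Type w} [ColourSpace M] {a b c e u : M} {A A' B B' C C' : Set M}

theorem d_eq_iff : d a b = E ↔ a = b :=
  ColourSpace.triOn.eq_iff a trivial b trivial

theorem d_comm (a b : M) : d a b = d b a :=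
  ColourSpace.triOn.symm a trivial b trivial

theorem d_tri (a b c : M) : tri (d a b) (d b c) (d a c) :=
  ColourSpace.triOn.tri a trivial b trivial c trivial

theorem d_self (a : M) : d a a = E := d_eq_iff.2 rfl

/-- The point `a` is independent from the point `c` over `B`. -/
def ind (B : Set M) (a c : M) : Prop :=
  (∃ b ∈ B, comp (d a b) (d b c) = some (d a c)) ∨
    (d a c = G ∧ ∀ b ∈ B, comp (d a b) (d b c) = none)

/-- Every point of `A` is independent from every point of `C` over `B`. -/
def Perp (A B C : Set M) : Prop := ∀ a ∈ A, ∀ c ∈ C, ind B a c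

theorem ind_symm (h : ind B a c) : ind B c a := by
  unfold ind at *
  rcases h with ⟨b, hb, h⟩ | ⟨h, h'⟩
  · exact Or.inl ⟨b, hb, by rw [comp_comm, d_comm b a, d_comm c b, h, d_comm a c]⟩
  · exact Or.inr ⟨by rw [d_comm, h], fun b hb => by
      rw [comp_comm, d_comm b a, d_comm c b, h' b hb]⟩

theorem ind_of_mem_left (h : a ∈ B) : ind B a c :=
  Or.inl ⟨a, h, by rw [d_self, comp_eq_left]⟩

theorem ind_of_mem_right (h : c ∈ B) : ind B a c := ind_symm (ind_of_mem_left h)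

/-- Only E and E compose to E. This makes the condition `A ∩ C = B` of the amalgam automatic. -/
theorem mem_of_ind_self (h : ind B a a) : a ∈ B := by
  rcases h with ⟨b, hb, h⟩ | ⟨h, -⟩
  · rw [d_self] at h
    exact d_eq_iff.1 (eq_of_comp_eq h).1 ▸ hb
  · rw [d_self] at h; cases h

/-- Witnesses in `B` persist. If the colour is the default G, a new base point that imposes a value
must be `a` or `e` itself, because values imposed by other points exclude G; the value imposed is
then G. -/
theorem ind_mono (hB : B ⊆ B') (h : ∀ x ∈ B', ind B a x) (he : ind B a e) : ind B' a e := by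
  rcases he with ⟨b, hb, h'⟩ | ⟨hG, hn⟩
  · exact Or.inl ⟨b, hB hb, h'⟩
  by_cases hw : ∃ x ∈ B', comp (d a x) (d x e) ≠ none
  · obtain ⟨x, hx, hne⟩ := hw
    refine Or.inl ⟨x, hx, ?_⟩
    have t := d_tri a x e
    rw [hG] at t ⊢
    rcases h x hx with ⟨b, hb, h'⟩ | ⟨hG', -⟩
    · have key : ∀ i j k, comp i j = some k → ∀ m, comp i m = none → ∀ l, tri j l m →
          comp k l ≠ none → tri k l G → comp k l = some G := by decide
      exact key _ _ _ h' _ (hn b hb) _ (d_tri b x e) hne t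
    · rw [hG'] at hne ⊢
      revert hne
      generalize d x e = l
      revert l; decide
  · push Not at hw
    exact Or.inr ⟨hG, hw⟩

/-- A witness in `B'` is traded for one in `B` by associativity of `comp`. Apart from E, the only
chain of two imposed values is XXX: here (XX)X = YX = R, and the triangles force X(XX) = XY = R. -/
theorem ind_trans (hB : B ⊆ B') (h : ∀ x ∈ B', ind B a x) (he : ind B' a e) : ind B a e := by
  rcases he with ⟨x, hx, h'⟩ | ⟨hG, hn⟩
  · by_cases hxe : x = e
    · exact hxe ▸ h x hx
    have hne : d x e ≠ E := fun h => hxe (d_eq_iff.1 h)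
    rcases h x hx with ⟨b, hb, h''⟩ | ⟨hG', -⟩
    · have key : ∀ i j k, comp i j = some k → ∀ l, l ≠ E → ∀ n, comp k l = some n → ∀ m,
          tri j l m → tri i m n → comp i m = some n := by decide
      exact Or.inl ⟨b, hb, key _ _ _ h'' _ hne _ h' _ (d_tri b x e) (d_tri a b e)⟩
    · exfalso
      rw [hG'] at h'
      revert h' hne
      generalize d x e = l, d a e = n
      revert l n; decide
  · exact Or.inr ⟨hG, fun b hb => hn b (hB hb)⟩

/-- The colour of an independent pair is determined by the types of its points over the base. -/
theorem d_eq_of_ind {a' c' : M} (f : M → M) (h : ind B a c) (h' : ind (f '' B) a' c')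
    (h1 : ∀ b ∈ B, d a' (f b) = d a b) (h2 : ∀ b ∈ B, d (f b) c' = d b c) :
    d a' c' = d a c := by
  rcases h with ⟨b, hb, h⟩ | ⟨hG, hn⟩
  · rcases h' with ⟨_, ⟨b', hb', rfl⟩, h'⟩ | ⟨hG', hn'⟩
    · have t := d_tri a' (f b) c'
      have t' := d_tri a b' c
      rw [h1 b hb, h2 b hb] at t
      rw [h1 b' hb', h2 b' hb'] at h'
      -- Two witnesses cannot disagree: a clash between Y and R is impossible because XX admits no
      -- colour but Y between distinct points.
      have key : ∀ i j u, comp i j = some u → ∀ v, tri i j v → ∀ i' j', comp i' j' = some v →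
          tri i' j' u → v = u := by decide
      exact key _ _ _ h _ t _ _ h' t'
    · have := hn' (f b) ⟨b, hb, rfl⟩
      rw [h1 b hb, h2 b hb, h] at this
      cases this
  · rcases h' with ⟨_, ⟨b', hb', rfl⟩, h'⟩ | ⟨hG', hn'⟩
    · rw [h1 b' hb', h2 b' hb', hn b' hb'] at h'
      cases h'
    · rw [hG, hG']

/-- The amalgam never uses X. This is the source of the pairs to which `ind_of_insert` applies. -/
theorem solution_of_ind (h : ind B a c) (ha : a ∉ B) (hc : c ∉ B) : Solution (d a c) := by
  rcases h with ⟨b, hb, h⟩ | ⟨h, -⟩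
  · refine solution_of_comp h (fun h => ha ?_) (fun h => hc ?_)
    · exact d_eq_iff.1 h ▸ hb
    · exact d_eq_iff.1 h ▸ hb
  · rw [h]; decide

/-- Two colours from R, G, Y impose nothing, so `u` cannot be a witness. This is the surviving part
of base reduction, with a condition on both colours at `u` instead of one. -/
theorem ind_of_insert (h : ind (insert u B) a c) (h1 : Solution (d a u)) (h2 : Solution (d u c)) :
    ind B a c := by
  rcases h with ⟨b, rfl | hb, h⟩ | ⟨h, hn⟩
  · rw [comp_eq_none h1 h2] at h; cases h
  · exact Or.inl ⟨b, hb, h⟩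
  · exact Or.inr ⟨h, fun b hb => hn b (Or.inr hb)⟩

theorem Perp.symm (h : Perp A B C) : Perp C B A := fun c hc a ha => ind_symm (h a ha c hc)

theorem Perp.subset (h : Perp A B C) (hA : A' ⊆ A) (hC : C' ⊆ C) : Perp A' B C' :=
  fun a ha c hc => h a (hA ha) c (hC hc)

theorem Perp.left (h : Perp A B C) (hA : A' ⊆ A) : Perp A' B C := h.subset hA subset_rfl

theorem Perp.right (h : Perp A B C) (hC : C' ⊆ C) : Perp A B C' := h.subset subset_rfl hC

theorem Perp.union_left (h : Perp A B C) (h' : Perp A' B C) : Perp (A ∪ A') B C :=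
  fun a ha c hc => ha.elim (fun ha => h a ha c hc) (fun ha => h' a ha c hc)

theorem Perp.union_right (h : Perp A B C) (h' : Perp A B C') : Perp A B (C ∪ C') :=
  fun a ha c hc => hc.elim (fun hc => h a ha c hc) (fun hc => h' a ha c hc)

theorem perp_of_subset_left (h : A ⊆ B) : Perp A B C := fun _ ha _ _ => ind_of_mem_left (h ha)

theorem perp_of_subset_right (h : C ⊆ B) : Perp A B C := fun _ _ _ hc => ind_of_mem_right (h hc)

theorem Perp.mono_base (h : Perp A B C) (hB : B ⊆ B') (h' : Perp A B B') : Perp A B' C :=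
  fun a ha c hc => ind_mono hB (h' a ha) (h a ha c hc)

theorem Perp.trans (h : Perp A B B') (hB : B ⊆ B') (h' : Perp A B' C) : Perp A B C :=
  fun a ha c hc => ind_trans hB (h a ha) (h' a ha c hc)

/-- If `A` is independent from `C` over `B'`, and `B'` from `C` over `B`, then `A` is independent
from `C` over `B`. -/
theorem Perp.chain (h : Perp A B' C) (h' : Perp B' B C) (hB : Perp A B' B) : Perp A B C := by
  have h1 : Perp A (B ∪ B') C := h.mono_base Set.subset_union_right
    (hB.union_right (perp_of_subset_right subset_rfl))
  exact (Perp.trans ((perp_of_subset_right subset_rfl).union_right h'.symm)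
    Set.subset_union_left h1.symm).symm

end Calculus

/-! ### Homogeneous actions -/

/-- `G` is the automorphism group of the countable homogeneous structure `M`. -/
class ColourHomogeneous (G : Type*) (M : Type w) [ColourSpace M] [Group G] [MulAction G M] :
    Prop where
  d_smul : ∀ (g : G) (a b : M), d (g • a) (g • b) = d a b
  extend_map : ∀ (A : Set M), A.Finite → ∀ f : M → M,
    (∀ a ∈ A, ∀ b ∈ A, d (f a) (f b) = d a b) → ∃ g : G, ∀ a ∈ A, g • a = f a
  one_point : ∀ (A : Set M), A.Finite → ∀ p : M → Hue, (∀ a ∈ A, p a ≠ E) →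
    (∀ a ∈ A, ∀ b ∈ A, tri (p a) (d a b) (p b)) → ∃ m : M, ∀ a ∈ A, d m a = p a
  full : ∀ e : Equiv.Perm M, (∀ a b, d (e a) (e b) = d a b) → ∃ g : G, ∀ x, g • x = e x
  faithful : ∀ g h : G, (∀ x : M, g • x = h • x) → g = h

/-- `g` fixes every point of `B`. -/
def Fixes {G M : Type*} [Group G] [MulAction G M] (g : G) (B : Set M) : Prop := ∀ b ∈ B, g • b = b

open Pointwise

section Action

variable {G : Type*} {M : Type w} [Group G] [MulAction G M] {g h : G} {A B C : Set M}

theorem Fixes.mul (hg : Fixes g B) (hh : Fixes h B) : Fixes (g * h) B := fun b hb => by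
  rw [mul_smul, hh b hb, hg b hb]

theorem Fixes.inv (hg : Fixes g B) : Fixes g⁻¹ B := fun b hb => by
  rw [inv_smul_eq_iff, hg b hb]

theorem Fixes.mono (hg : Fixes g B) (h : A ⊆ B) : Fixes g A := fun b hb => hg b (h hb)

theorem fixes_one (B : Set M) : Fixes (1 : G) B := fun b _ => one_smul G b

theorem smul_set_congr (h' : ∀ x ∈ A, g • x = h • x) : g • A = h • A :=
  Set.image_congr h'

theorem Fixes.smul_set (hg : Fixes g A) : g • A = A := by
  rw [smul_set_congr (h := 1) (fun x hx => by rw [hg x hx, one_smul]), one_smul]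

variable [ColourSpace M] [ColourHomogeneous G M]

theorem ind_smul (g : G) {a c : M} (h : ind B a c) : ind (g • B) (g • a) (g • c) := by
  rcases h with ⟨b, hb, h⟩ | ⟨h, hn⟩
  · refine Or.inl ⟨g • b, Set.smul_mem_smul_set hb, ?_⟩
    simpa only [ColourHomogeneous.d_smul] using h
  · refine Or.inr ⟨by rwa [ColourHomogeneous.d_smul], ?_⟩
    rintro _ ⟨b, hb, rfl⟩
    simpa only [ColourHomogeneous.d_smul] using hn b hb

theorem Perp.smul (g : G) (h : Perp A B C) : Perp (g • A) (g • B) (g • C) := by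
  rintro _ ⟨a, ha, rfl⟩ _ ⟨c, hc, rfl⟩
  exact ind_smul g (h a ha c hc)

/-- Points with the same colours over a finite set lie in the same orbit of its stabiliser. -/
theorem exists_fixes_smul_eq (G : Type*) [Group G] [MulAction G M] [ColourHomogeneous G M]
    {x a : M} (hB : B.Finite) (h : ∀ b ∈ B, d a b = d x b) : ∃ g : G, Fixes g B ∧ g • x = a := by
  classical
  by_cases hx : x ∈ B
  · have : a = x := d_eq_iff.1 (by rw [h x hx, d_self])
    exact ⟨1, fixes_one B, by rw [this, one_smul]⟩
  have hne : ∀ b ∈ B, b ≠ x := fun b hb h => hx (h ▸ hb)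
  obtain ⟨g, hg⟩ := ColourHomogeneous.extend_map (G := G) (insert x B) (hB.insert x)
    (fun y => if y = x then a else y) (by
      rintro y (rfl | hy) z (rfl | hz)
      · simp [d_self]
      · simp [hne z hz, h z hz]
      · simp only [hne y hy, if_true, if_false]
        rw [d_comm y a, h y hy, d_comm]
      · simp [hne z hz, hne y hy])
  exact ⟨g, fun b hb => by rw [hg b (Or.inr hb), if_neg (hne b hb)],
    by simpa using hg x (Or.inl rfl)⟩

-- By `freeValue_tri` the values `freeValue` form a consistent type over `B ∪ C`. A realisation has
-- the colours of `x` over `B`, so homogeneity moves `x` to it.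
variable (G) in
theorem exists_ind (x : M) (hB : B.Finite) (hC : C.Finite) :
    ∃ g : G, Fixes g B ∧ ∀ c ∈ C, ind B (g • x) c := by
  by_cases hx : x ∈ B
  · exact ⟨1, fixes_one B, fun c _ => by rw [one_smul]; exact ind_of_mem_left hx⟩
  have hp : ∀ b ∈ B, d x b ≠ E := fun b hb h => hx (d_eq_iff.1 h ▸ hb)
  have ht := freeValue_tri (d := d) (S := Set.univ) (B := B) (p := d x) ColourSpace.triOn
    (Set.subset_univ B) hp (fun b _ b' _ => d_tri x b b')
  obtain ⟨m, hm⟩ := ColourHomogeneous.one_point (G := G) (B ∪ C) (hB.union hC)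
    (freeValue d B (d x)) (fun a _ => freeValue_ne_eq d hp a)
    (fun a _ b _ => ht a trivial b trivial)
  have hmB : ∀ b ∈ B, d m b = d x b := fun b hb => by
    rw [hm b (Or.inl hb)]; simp [freeValue, hb]
  obtain ⟨g, hg, hgx⟩ := exists_fixes_smul_eq G hB hmB
  refine ⟨g, hg, fun c hc => ?_⟩
  · rw [hgx]
    have hmc := hm c (Or.inr hc)
    rcases freeValue_cases d B (d x) c with ⟨h, -⟩ | ⟨-, e, b, hb, h1, h2⟩ |
      ⟨-, e, -, b, hb, h⟩ | ⟨hcB, e, h0, h1, h2⟩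
    · exact ind_of_mem_right h
    · exact Or.inl ⟨b, hb, by rw [hmB b hb, h1, h2, hmc, e]; rfl⟩
    · refine Or.inl ⟨b, hb, ?_⟩
      rw [hmB b hb, hmc, e]
      rcases h with ⟨h1, h2⟩ | ⟨h1, h2⟩ <;> rw [h1, h2] <;> rfl
    · refine Or.inr ⟨by rw [hmc, e], fun b hb => ?_⟩
      rw [hmB b hb]
      have h3 := hp b hb
      have h4 : d b c ≠ E := fun h => hcB (d_eq_iff.1 h ▸ hb)
      have := h0 b hb; have := h1 b hb; have := h2 b hb
      revert h3 h4
      generalize d x b = i, d b c = j at *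
      revert i j; decide

/-- The points of `A` are placed one at a time, each independent from `C` over `B` and the points
already placed; transitivity then removes the latter from the base. -/
theorem exists_perp (G : Type*) [Group G] [MulAction G M] [ColourHomogeneous G M]
    (hA : A.Finite) (hB : B.Finite) (hC : C.Finite) :
    ∃ g : G, Fixes g B ∧ Perp (g • A) B C := by
  induction A, hA using Set.Finite.induction_on with
  | empty => exact ⟨1, fixes_one B, by simp [Perp]⟩
  | @insert x A _ hA ih =>
    obtain ⟨g, hg, hgA⟩ := ih
    obtain ⟨k, hk, hkx⟩ := exists_ind G (g • x) (B := B ∪ g • A) (C := C)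
      (hB.union hA.smul_set) hC
    have hk1 := hk.mono Set.subset_union_left
    have hkA : (k * g) • A = g • A := by
      rw [mul_smul, (hk.mono Set.subset_union_right).smul_set]
    refine ⟨k * g, hk1.mul hg, ?_⟩
    rintro _ ⟨y, rfl | hy, rfl⟩ c hc
    · have h1 : Perp {k • g • y} (B ∪ g • A) C := fun a ha c hc => by
        rw [Set.mem_singleton_iff.1 ha]; exact hkx c hc
      have h2 : Perp C B (B ∪ g • A) := (perp_of_subset_right subset_rfl).union_right hgA.symm
      have := (h2.trans Set.subset_union_left h1.symm).symm
      exact this _ (by simp [mul_smul]) c hc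
    · exact hgA _ (hkA ▸ Set.smul_mem_smul_set hy) c hc

/-- Stationarity: independent sets are glued along automorphisms that agree on the base. -/
theorem exists_glue (hA : A.Finite) (hC : C.Finite)
    (hgh : ∀ b ∈ B, g • b = h • b) (h1 : Perp A B C) (h2 : Perp (g • A) (g • B) (h • C)) :
    ∃ k : G, (∀ a ∈ A, k • a = g • a) ∧ ∀ c ∈ C, k • c = h • c := by
  classical
  -- A common point of `A` and `C` is independent from itself, so it lies in `B`, where `g` and `h`
  -- agree.
  have hAC : ∀ a ∈ A, a ∈ C → g • a = h • a := fun a ha hc =>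
    hgh a (mem_of_ind_self (h1 a ha a hc))
  have hd : ∀ a ∈ A, ∀ c ∈ C, d (g • a) (h • c) = d a c := fun a ha c hc =>
    d_eq_of_ind (fun b => g • b) (h1 a ha c hc)
      (h2 _ (Set.smul_mem_smul_set ha) _ (Set.smul_mem_smul_set hc))
      (fun b _ => ColourHomogeneous.d_smul g a b)
      (fun b hb => by simp only [hgh b hb, ColourHomogeneous.d_smul])
  obtain ⟨k, hk⟩ := ColourHomogeneous.extend_map (G := G) (A ∪ C) (hA.union hC)
    (fun x => if x ∈ C then h • x else g • x) (by
      intro a ha b hb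
      by_cases haC : a ∈ C <;> by_cases hbC : b ∈ C
      · simp [haC, hbC, ColourHomogeneous.d_smul]
      · have hb := hb.resolve_right hbC
        simp only [haC, hbC, if_true, if_false]
        rw [d_comm, hd b hb a haC, d_comm]
      · have ha := ha.resolve_right haC
        simp only [haC, hbC, if_true, if_false]
        exact hd a ha b hbC
      · simp [haC, hbC, ColourHomogeneous.d_smul])
  refine ⟨k, fun a ha => ?_, fun c hc => ?_⟩
  · rw [hk a (Or.inl ha)]
    by_cases haC : a ∈ C
    · rw [if_pos haC, hAC a ha haC]
    · rw [if_neg haC]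
  · rw [hk c (Or.inr hc), if_pos hc]

/-- A sequence of automorphisms that stabilises on an exhausting sequence of sets converges. -/
theorem exists_limit (a : ℕ → G) (F : ℕ → Set M) (hF : Monotone F) (hx : ∀ x, ∃ n, x ∈ F n)
    (hy : ∀ y, ∃ n, (a n)⁻¹ • y ∈ F n) (ha : ∀ n, ∀ x ∈ F n, a (n + 1) • x = a n • x) :
    ∃ g : G, ∀ n, ∀ x ∈ F n, g • x = a n • x := by
  have stable : ∀ n m, n ≤ m → ∀ x ∈ F n, a m • x = a n • x := by
    intro n m hnm
    induction m, hnm using Nat.le_induction with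
    | base => exact fun _ _ => rfl
    | succ m hm ih => exact fun x hxn => (ha m x (hF hm hxn)).trans (ih x hxn)
  choose N hN using hx
  have he : ∀ n, ∀ x ∈ F n, a (N x) • x = a n • x := by
    intro n x hxn
    rcases le_total n (N x) with h | h
    · exact stable n _ h x hxn
    · exact (stable _ n h x (hN x)).symm
  have he2 : ∀ x y, ∃ n, x ∈ F n ∧ y ∈ F n := fun x y =>
    ⟨max (N x) (N y), hF (le_max_left _ _) (hN x), hF (le_max_right _ _) (hN y)⟩
  have hbij : Function.Bijective fun x => a (N x) • x := by
    constructor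
    · intro x y hxy
      obtain ⟨n, h1, h2⟩ := he2 x y
      simp only [he n x h1, he n y h2] at hxy
      exact smul_left_cancel _ hxy
    · intro y
      obtain ⟨n, hn⟩ := hy y
      exact ⟨(a n)⁻¹ • y, by simp only [he n _ hn, smul_inv_smul]⟩
  obtain ⟨g, hg⟩ := ColourHomogeneous.full (G := G) (Equiv.ofBijective _ hbij) (by
    intro x y
    obtain ⟨n, h1, h2⟩ := he2 x y
    simp only [Equiv.ofBijective_apply, he n x h1, he n y h2, ColourHomogeneous.d_smul])
  exact ⟨g, fun n x hxn => by rw [hg]; exact he n x hxn⟩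

end Action

/-! ### Generic automorphisms -/

theorem exists_seq_of_step {σ : Type*} (P : σ → Prop) (s₀ : σ) (h₀ : P s₀)
    (step : ℕ → σ → σ → Prop) (h : ∀ n s, P s → ∃ s', P s' ∧ step n s s') :
    ∃ s : ℕ → σ, ∀ n, P (s n) ∧ step n (s n) (s (n + 1)) := by
  choose f hf hf' using h
  let t : ℕ → {s // P s} := fun n =>
    Nat.rec ⟨s₀, h₀⟩ (fun n s => ⟨f n s.1 s.2, hf n s.1 s.2⟩) n
  exact ⟨fun n => (t n).1, fun n => ⟨(t n).2, hf' n (t n).1 (t n).2⟩⟩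

section Generic

variable {G : Type*} {M : Type w} [Group G] [MulAction G M] [ColourSpace M]
  [ColourHomogeneous G M] {g : G} {X : Set M}

theorem nonempty_of_homogeneous (G : Type*) (M : Type w) [Group G] [MulAction G M] [ColourSpace M]
    [ColourHomogeneous G M] : Nonempty M :=
  (ColourHomogeneous.one_point (G := G) (M := M) ∅ Set.finite_empty (fun _ => Hue.G)
    (by simp) (by simp)).nonempty

/-- Countably many requirements that can be met by prescribing finitely many values can be met
simultaneously. -/
theorem exists_generic [Countable M] {ι : Type*} [Countable ι] (R : ι → G → Prop)
    (hR : ∀ i (h : G) (F : Set M), F.Finite → ∃ h₁ : G, ∃ F' : Set M, F'.Finite ∧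
      (∀ x ∈ F, h₁ • x = h • x) ∧ ∀ h' : G, (∀ x ∈ F', h' • x = h₁ • x) → R i h') :
    ∃ h : G, ∀ i, R i h := by
  have := nonempty_of_homogeneous G M
  obtain ⟨x, hx⟩ := exists_surjective_nat M
  rcases isEmpty_or_nonempty ι with hι | hι
  · exact ⟨1, fun i => hι.elim i⟩
  obtain ⟨i, hi⟩ := exists_surjective_nat ι
  obtain ⟨s, hs⟩ := exists_seq_of_step (σ := G × Set M) (fun s => s.2.Finite) (1, ∅)
    Set.finite_empty
    (fun n s s' => s.2 ⊆ s'.2 ∧ x n ∈ s'.2 ∧ s'.1⁻¹ • x n ∈ s'.2 ∧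
      (∀ y ∈ s.2, s'.1 • y = s.1 • y) ∧ ∀ h', (∀ y ∈ s'.2, h' • y = s'.1 • y) → R (i n) h') (by
      rintro n ⟨h, F⟩ hF
      obtain ⟨h₁, F', hF', h1, h2⟩ := hR (i n) h F hF
      -- Adding `x n` and its preimage makes the limit defined everywhere and surjective.
      refine ⟨(h₁, F ∪ F' ∪ {x n, h₁⁻¹ • x n}), (hF.union hF').union (Set.toFinite _), ?_, ?_, ?_,
        h1, fun h' hh => h2 h' fun y hy => hh y (Or.inl (Or.inr hy))⟩
      · exact fun y hy => Or.inl (Or.inl hy)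
      · exact Or.inr (Or.inl rfl)
      · exact Or.inr (Or.inr rfl))
  obtain ⟨h, hh⟩ := exists_limit (fun n => (s n).1) (fun n => (s n).2)
    (monotone_nat_of_le_succ fun n => (hs n).2.1)
    (fun y => (hx y).imp' (· + 1) fun n hn => hn ▸ (hs n).2.2.1)
    (fun y => (hx y).imp' (· + 1) fun n hn => hn ▸ (hs n).2.2.2.1)
    (fun n => (hs n).2.2.2.2.1)
  refine ⟨h, fun j => ?_⟩
  obtain ⟨n, rfl⟩ := hi j
  exact (hs n).2.2.2.2.2 h (hh (n + 1))

/-! ### Moving points -/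

/-- A one-point type can be extended to a new point by any compatible colour. -/
theorem exists_fixes_d_eq (G : Type*) [Group G] [MulAction G M] [ColourHomogeneous G M]
    {x n : M} (hX : X.Finite) (hx : x ∉ X) (hn : n ∉ X) {c : Hue} (hc : c ≠ E)
    (h : ∀ y ∈ X, tri (d x y) (d y n) c) : ∃ s : G, Fixes s X ∧ d (s • x) n = c := by
  classical
  have hne : ∀ y ∈ X, y ≠ n := fun y hy h => hn (h ▸ hy)
  obtain ⟨a, ha⟩ := ColourHomogeneous.one_point (G := G) (insert n X) (hX.insert n)
    (fun y => if y = n then c else d x y) (by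
      rintro y (rfl | hy)
      · simpa using hc
      · simp only [hne y hy, if_false]
        exact fun h => hx (d_eq_iff.1 h ▸ hy)) (by
      rintro y (rfl | hy) z (rfl | hz)
      · simp only [if_true, d_self]; exact tri_eq_mid c
      · simp only [hne z hz, if_true, if_false]
        rw [d_comm]; exact tri_rotate (h z hz)
      · simp only [hne y hy, if_true, if_false]
        exact h y hy
      · simp only [hne y hy, hne z hz, if_false]
        exact d_tri x y z)
  obtain ⟨s, hs, hsx⟩ := exists_fixes_smul_eq G (x := x) (a := a) hX (fun y hy => by
    rw [ha y (Or.inr hy), if_neg (hne y hy)])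
  exact ⟨s, hs, by rw [hsx, ha n (Or.inl rfl), if_pos rfl]⟩

/-- No triangle of `S` contains GG or RG, so one R and otherwise G is always a consistent type. -/
theorem exists_red_green (G : Type*) [Group G] [MulAction G M] [ColourHomogeneous G M]
    (m : M) (hX : X.Finite) : ∃ n, d n m = R ∧ ∀ y ∈ X, y ≠ m → d n y = Hue.G := by
  classical
  obtain ⟨n, hn⟩ := ColourHomogeneous.one_point (G := G) (insert m X) (hX.insert m)
    (fun y => if y = m then R else Hue.G) (fun y _ => by split_ifs <;> decide) (by
      intro y _ z _
      by_cases hy : y = m <;> by_cases hz : z = m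
      · subst hy hz; simp only [d_self]; exact tri_eq_mid _
      · have : d y z ≠ E := fun h => hz ((d_eq_iff.1 h).symm.trans hy)
        simp only [hy, hz, if_true, if_false] at this ⊢
        revert this
        generalize d m z = i
        revert i; decide
      · have : d y z ≠ E := fun h => hy ((d_eq_iff.1 h).trans hz)
        simp only [hy, hz, if_true, if_false] at this ⊢
        revert this
        generalize d y m = i
        revert i; decide
      · simp only [hy, hz, if_false]
        generalize d y z = i
        revert i; decide)
  exact ⟨n, by rw [hn m (Or.inl rfl), if_pos rfl],
    fun y hy hym => by rw [hn y (Or.inr hy), if_neg hym]⟩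

theorem ne_of_red_green {m n : M} (h1 : d n m = R) (h2 : d n (g • m) = Hue.G) :
    g • n ≠ n := by
  intro h
  have := ColourHomogeneous.d_smul g n m
  rw [h, h1, h2] at this
  cases this

/-- A non-trivial automorphism moves some realisation of every non-trivial one-point type. -/
theorem exists_moved (hg : g ≠ 1) (hX : X.Finite) {x : M} (hx : x ∉ X) :
    ∃ s : G, Fixes s X ∧ g • s • x ≠ s • x := by
  obtain ⟨m, hm⟩ : ∃ m : M, g • m ≠ m := by
    by_contra! h
    exact hg (ColourHomogeneous.faithful g 1 fun x => by rw [h x, one_smul])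
  -- The point `m` may lie in `X`, and then `n₁` has an R edge to `X`. Since `n₁` itself is outside
  -- `X`, repeating the construction from `n₁` gives a moved point `n` with only G edges to `X`.
  obtain ⟨n₁, h1, h2⟩ := exists_red_green G m (hX.insert (g • m))
  have hn₁ : g • n₁ ≠ n₁ := ne_of_red_green h1 (h2 _ (Or.inl rfl) hm)
  have hn₁X : n₁ ∉ X := fun h => by
    by_cases hm : n₁ = m
    · rw [hm, d_self] at h1; cases h1
    · have := h2 n₁ (Or.inr h) hm
      rw [d_self] at this; cases this
  obtain ⟨n, h3, h4⟩ := exists_red_green G n₁ (hX.insert (g • n₁))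
  have hn : g • n ≠ n := ne_of_red_green h3 (h4 _ (Or.inl rfl) hn₁)
  have hnX : ∀ y ∈ X, d n y = Hue.G := fun y hy => h4 y (Or.inr hy) (fun h => hn₁X (h ▸ hy))
  have hnX' : n ∉ X := fun h => by
    have := hnX n h
    rw [d_self] at this; cases this
  -- A fixed point of `g` has equal colours to `n` and `g • n`, so the colour `c` to `n` will be
  -- chosen different from the colour to `g • n`. Both R and G are compatible with the G edges from
  -- `n` to `X`. Independence from `g • n` ensures that one of them fits the triangle with `n` and
  -- `g • n`: it rules out the colour X to `g • n`, unless `g • n` is in `X` and so has a G edge to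
  -- `n`.
  obtain ⟨t, ht, htx⟩ := exists_ind G x hX (Set.finite_singleton (g • n))
  have hx' : t • x ∉ X := fun h => hx (by
    have := ht.inv _ h
    rw [inv_smul_smul] at this
    rwa [← this] at h)
  have hj : Solution (d (t • x) (g • n)) ∨ d (g • n) n = Hue.G := by
    by_cases h : g • n ∈ X
    · exact Or.inr (by rw [d_comm]; exact hnX _ h)
    · exact Or.inl (solution_of_ind (htx _ rfl) hx' h)
  have hj' : d (t • x) (g • n) ≠ E := fun h => by
    have h := d_eq_iff.1 h
    have h' := htx _ rfl
    rw [← h] at h'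
    exact hx' (mem_of_ind_self h')
  have hgn : d (g • n) n ≠ E := fun h => hn (d_eq_iff.1 h)
  have key : ∀ j e, j ≠ E → e ≠ E → Solution j ∨ e = Hue.G →
      ∃ c, (c = R ∨ c = Hue.G) ∧ c ≠ j ∧ tri j e c := by decide
  obtain ⟨c, hc, hcj, hct⟩ := key _ _ hj' hgn hj
  obtain ⟨s, hs, hsx⟩ := exists_fixes_d_eq G (X := insert (g • n) X) (x := t • x) (n := n) (c := c)
    (hX.insert _) (fun h => h.elim (fun h => hj' (d_eq_iff.2 h)) hx')
    (fun h => h.elim (fun h => hn h.symm) hnX') (by rcases hc with rfl | rfl <;> decide) (by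
      rintro y (rfl | hy)
      · exact hct
      · rw [d_comm y n, hnX y hy]
        have : d (t • x) y ≠ E := fun h => hx' (d_eq_iff.1 h ▸ hy)
        revert this
        generalize d (t • x) y = i
        rcases hc with rfl | rfl <;> revert i <;> decide)
  refine ⟨s * t, (hs.mono fun y hy => Or.inr hy).mul ht, fun h => ?_⟩
  rw [mul_smul] at h
  have h5 := ColourHomogeneous.d_smul g (s • t • x) n
  have h6 := ColourHomogeneous.d_smul s (t • x) (g • n)
  rw [hs (g • n) (Or.inl rfl)] at h6
  rw [h, hsx, h6] at h5
  exact hcj h5.symm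

end Generic

/-! ### Commutators with generic automorphisms -/

section Commutators

variable {G : Type*} {M : Type w} [Group G] [MulAction G M] [ColourSpace M]
  [ColourHomogeneous G M] {g k : G} {X : Set M}

/-- Every type over `X` that is independent from `k X` has a realisation `a` such that `k a` is
reached from `a` through `g a` in an independent way, by pairs with colours in `Q`. -/
def ReachesThrough (Q : Hue → Prop) (g k : G) (X : Set M) (x : M) : Prop :=
  x ∉ X → (∀ y ∈ k • X, ind X x y) → ∃ s : G, ∃ X' : Set M, Fixes s (X ∪ k • X) ∧
    X ⊆ X' ∧ k • X ⊆ X' ∧ Q (d (s • x) (g • s • x)) ∧ Q (d (g • s • x) (k • s • x)) ∧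
    s • x ∉ X' ∧ k • s • x ∉ X' ∧ (∀ z ∈ X', ind X (s • x) z) ∧
    (∀ z ∈ X', ind (k • X) (k • s • x) z) ∧ ind (insert (g • s • x) X') (k • s • x) (s • x)

/-- Since `k a = h⁻¹ g⁻¹ h g a`, put `u = g a`, let the modified `h` send `u` to `g w` for a generic
`w`, and choose a generic preimage `a'` of `w`; then `k a = a'`. The colour of `(u, a')` is that of
`(g w, w)`, so the hypothesis on `g` gives `Q` both for `a` and for `w`. -/
theorem ReachesThrough.exists_extension {Q : Hue → Prop}
    (hg : ∀ (X : Set M), X.Finite → ∀ x ∉ X, ∃ s : G, Fixes s X ∧ Q (d (s • x) (g • s • x)))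
    (hX : X.Finite) (x : M) (h : G) {F : Set M} (hF : F.Finite) :
    ∃ h₁ : G, ∃ F' : Set M, F'.Finite ∧ (∀ x ∈ F, h₁ • x = h • x) ∧
      ∀ h' : G, (∀ x ∈ F', h' • x = h₁ • x) →
        ReachesThrough Q g (groupCommutator h' g) X x := by
  set k := groupCommutator h g with hk
  -- The values of `h` on `g • X` and `k • X` determine the commutator on `X`.
  set X' : Set M := F ∪ X ∪ g • X ∪ k • X with hX'
  have hFX' : F ⊆ X' := fun y hy => Or.inl (Or.inl (Or.inl hy))
  have hXX' : X ⊆ X' := fun y hy => Or.inl (Or.inl (Or.inr hy))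
  have hgX' : g • X ⊆ X' := fun y hy => Or.inl (Or.inr hy)
  have hkX' : k • X ⊆ X' := fun y hy => Or.inr hy
  have hX'f : X'.Finite := ((hF.union hX).union hX.smul_set).union hX.smul_set
  have hcomm : ∀ h' : G, (∀ y ∈ X', h' • y = h • y) → ∀ y ∈ X,
      groupCommutator h' g • y = k • y := by
    intro h' hh y hy
    have h1 := hh _ (hgX' (Set.smul_mem_smul_set hy))
    have h2 := hh _ (hkX' (Set.smul_mem_smul_set hy))
    simp only [hk, groupCommutator, mul_smul, smul_inv_smul] at h1 h2 ⊢
    rw [h1, inv_smul_eq_iff, h2]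
  by_cases H : x ∉ X ∧ ∀ y ∈ k • X, ind X x y
  swap
  -- The set `k • X` is already decided, so a premise that fails now fails for all later `h'`.
  · refine ⟨h, X', hX'f, fun _ _ => rfl, fun h' hh h1 h2 => absurd ⟨h1, ?_⟩ H⟩
    rwa [smul_set_congr (hcomm h' hh)] at h2
  obtain ⟨hxX, hxk⟩ := H
  -- a realisation `a` of the type that is independent from everything chosen so far
  have hW : (X' ∪ g⁻¹ • X').Finite := hX'f.union hX'f.smul_set
  obtain ⟨s₁, hs₁, hs₁x⟩ := exists_ind G x (hX.union (hX.smul_set (a := k))) hW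
  have hx1 : ∀ z ∈ X' ∪ g⁻¹ • X', ind X (s₁ • x) z := by
    intro z hz
    refine ind_trans Set.subset_union_left ?_ (hs₁x z hz)
    rintro y (hy | hy)
    · exact ind_of_mem_right hy
    · have := ind_smul s₁ (hxk y hy)
      rwa [(hs₁.mono Set.subset_union_left).smul_set, hs₁ y (Or.inr hy)] at this
  have hx1' : s₁ • x ∉ X' ∪ g⁻¹ • X' := fun hmem => by
    have h1 := mem_of_ind_self (hx1 _ hmem)
    have h2 := hs₁.inv _ (Or.inl h1)
    rw [inv_smul_smul] at h2
    exact hxX (h2 ▸ h1)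
  obtain ⟨s₂, hs₂, hQ₂⟩ := hg _ hW _ hx1'
  set s := s₂ * s₁ with hs
  have hsfix : Fixes s (X ∪ k • X) :=
    (hs₂.mono fun y hy => Or.inl (Set.union_subset hXX' hkX' hy)).mul hs₁
  rw [← mul_smul, ← hs] at hQ₂
  have hax : s₂ • s₁ • x = s • x := by rw [hs, mul_smul]
  have ha : ∀ z ∈ X' ∪ g⁻¹ • X', ind X (s • x) z := by
    intro z hz
    have := ind_smul s₂ (hx1 z hz)
    rwa [(hs₂.mono (hXX'.trans Set.subset_union_left)).smul_set, hs₂ z hz, hax] at this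
  have ha' : s • x ∉ X' ∪ g⁻¹ • X' := fun hmem => by
    have := hs₂.inv _ hmem
    rw [← hax, inv_smul_smul, hax] at this
    exact hx1' (this ▸ hmem)
  set a := s • x with haa
  set u := g • a with hu
  have huX' : u ∉ X' := fun hmem => ha' (Or.inr (by
    rw [Set.mem_smul_set_iff_inv_smul_mem, inv_inv]; exact hmem))
  have hui : ∀ z ∈ X', ind (g • X) u z := by
    intro z hz
    have := ind_smul g (ha (g⁻¹ • z) (Or.inr (Set.smul_mem_smul_set hz)))
    rwa [smul_inv_smul] at this
  -- a generic image `v` of `u`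
  set w₀ := g⁻¹ • h • u with hw₀
  have hw₀i : ∀ z ∈ g⁻¹ • h • X', ind (h • k • X) w₀ z := by
    rintro _ ⟨_, ⟨z, hz, rfl⟩, rfl⟩
    have := ind_smul g⁻¹ (ind_smul h (hui z hz))
    have e : h • k • X = g⁻¹ • h • g • X := by
      simp only [hk, groupCommutator, mul_smul, smul_inv_smul]
    rwa [e]
  have hw₀n : w₀ ∉ g⁻¹ • h • X' := by
    rw [hw₀, Set.smul_mem_smul_set_iff, Set.smul_mem_smul_set_iff]; exact huX'
  have hkW : h • k • X ⊆ g⁻¹ • h • X' := by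
    have e : h • k • X = g⁻¹ • h • g • X := by
      simp only [hk, groupCommutator, mul_smul, smul_inv_smul]
    rw [e]
    exact Set.smul_set_mono (Set.smul_set_mono hgX')
  have hYf : (g⁻¹ • h • X').Finite := hX'f.smul_set.smul_set
  have hYf' : (h • X').Finite := hX'f.smul_set
  obtain ⟨t₁, ht₁, ht₁w⟩ := exists_ind G w₀ hYf hYf'
  have hw1 : ∀ z ∈ h • X', ind (h • k • X) (t₁ • w₀) z := by
    intro z hz
    refine ind_trans hkW (fun y hy => ?_) (ht₁w z hz)
    have := ind_smul t₁ (hw₀i y hy)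
    rwa [(ht₁.mono hkW).smul_set, ht₁ y hy] at this
  have hw1n : t₁ • w₀ ∉ g⁻¹ • h • X' := fun hmem => by
    have := ht₁.inv _ hmem
    rw [inv_smul_smul] at this
    exact hw₀n (this ▸ hmem)
  have hw1n' : t₁ • w₀ ∉ g⁻¹ • h • X' ∪ h • X' := by
    rintro (hmem | hmem)
    · exact hw1n hmem
    · exact hw1n (hkW (mem_of_ind_self (hw1 _ hmem)))
  obtain ⟨t₂, ht₂, hQw⟩ := hg _ (hYf.union hYf') _ hw1n'
  set w := t₂ • t₁ • w₀ with hw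
  have hwi : ∀ z ∈ h • X', ind (h • k • X) w z := by
    intro z hz
    have := ind_smul t₂ (hw1 z hz)
    rwa [(ht₂.mono (hkW.trans Set.subset_union_left)).smul_set, ht₂ z (Or.inr hz)] at this
  have hwn : w ∉ h • X' := fun hmem => by
    have := ht₂.inv _ (Or.inr hmem)
    rw [hw, inv_smul_smul, ← hw] at this
    exact hw1n' (Or.inr (this ▸ hmem))
  -- `κ` fixes `h • X'` pointwise and carries `h • u` to `g • w`, so `κ * h` has the desired value
  -- at `u` and is unchanged on `X'`.
  set κ := g * t₂ * t₁ * g⁻¹ with hκ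
  have hκf : Fixes κ (h • X') := by
    intro y hy
    have h1 : g⁻¹ • y ∈ g⁻¹ • h • X' := Set.smul_mem_smul_set hy
    rw [hκ]
    simp only [mul_smul]
    rw [ht₁ _ h1, ht₂ _ (Or.inl h1), smul_inv_smul]
  have hκu : κ • h • u = g • w := by
    simp only [hκ, mul_smul, hw, hw₀]
  -- the preimage of `g⁻¹ v`
  obtain ⟨r, hr, hra⟩ := exists_ind G ((κ * h)⁻¹ • w) (hX'f.insert u) (Set.finite_singleton a)
  have hrX' := hr.mono (Set.subset_insert u X')
  set h₁ := κ * h * r⁻¹ with hh₁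
  have hh₁X' : ∀ y ∈ X', h₁ • y = h • y := by
    intro y hy
    rw [hh₁, mul_smul, hrX'.inv y hy, mul_smul, hκf _ (Set.smul_mem_smul_set hy)]
  have hh₁u : h₁ • u = g • w := by
    rw [hh₁, mul_smul, hr.inv u (Or.inl rfl), mul_smul, hκu]
  set a' := r • (κ * h)⁻¹ • w with hra'
  have hh₁a' : h₁ • a' = w := by
    rw [hh₁, hra', mul_smul, inv_smul_smul, smul_inv_smul]
  refine ⟨h₁, X' ∪ {u, a'}, hX'f.union (Set.toFinite _), fun y hy => hh₁X' y (hFX' hy), ?_⟩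
  intro h' hh' _ _
  have hh'X : ∀ y ∈ X', h' • y = h • y := fun y hy => (hh' y (Or.inl hy)).trans (hh₁X' y hy)
  have hh'u : h' • u = g • w := (hh' u (Or.inr (Or.inl rfl))).trans hh₁u
  have hh'a : h' • a' = w := (hh' a' (Or.inr (Or.inr rfl))).trans hh₁a'
  have hkX : groupCommutator h' g • X = k • X := smul_set_congr (hcomm h' hh'X)
  have hka : groupCommutator h' g • a = a' := by
    rw [groupCommutator, mul_smul, ← hu, mul_smul, mul_smul, hh'u, inv_smul_smul, ← hh'a,
      inv_smul_smul]
  have hkX'' : h₁ • k • X = h • k • X := smul_set_congr fun y hy => hh₁X' y (hkX' hy)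
  refine ⟨s, X', ?_⟩
  rw [hkX, ← haa, hka]
  refine ⟨hsfix, hXX', hkX', hQ₂, ?_, fun hmem => ha' (Or.inl hmem), fun hmem => ?_,
    fun z hz => ha z (Or.inl hz), fun z hz => ?_, hra a rfl⟩
  · have := ColourHomogeneous.d_smul h₁ u a'
    rw [hh₁u, hh₁a'] at this
    rw [← hu, ← this, d_comm]
    exact hQw
  · have := Set.smul_mem_smul_set (a := h₁) hmem
    rw [hh₁a', smul_set_congr hh₁X'] at this
    exact hwn this
  · have := ind_smul h₁⁻¹ (hwi (h₁ • z) (by rw [hh₁X' z hz]; exact Set.smul_mem_smul_set hz))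
    rwa [← hkX'', inv_smul_smul, inv_smul_smul, ← hh₁a', inv_smul_smul] at this

theorem exists_reachesThrough [Countable M] {Q : Hue → Prop}
    (hg : ∀ (X : Set M), X.Finite → ∀ x ∉ X, ∃ s : G, Fixes s X ∧ Q (d (s • x) (g • s • x))) :
    ∃ h : G, ∀ X : Set M, X.Finite → ∀ x, ReachesThrough Q g (groupCommutator h g) X x := by
  obtain ⟨h, hh⟩ := exists_generic (G := G) (ι := Finset M × M)
    (fun i h => ReachesThrough Q g (groupCommutator h g) i.1 i.2)
    (fun i h F hF => ReachesThrough.exists_extension hg i.1.finite_toSet i.2 h hF)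
  exact ⟨h, fun X hX x => by simpa using hh (hX.toFinset, x)⟩

/-- Every non-trivial one-point type has a realisation `a` such that the colour of `(a, g a)` is
one of those used by the amalgamation. -/
def MovesBySolution (M : Type w) [MulAction G M] [ColourSpace M] (g : G) : Prop :=
  ∀ (X : Set M), X.Finite → ∀ x ∉ X, ∃ s : G, Fixes s X ∧ Solution (d (s • x) (g • s • x))

/-- Every one-point type over `X` that is independent from `g X` has a realisation whose image
under `g` is as independent as possible. -/
def MovesMaximally (M : Type w) [MulAction G M] [ColourSpace M] (g : G) : Prop :=
  ∀ (X : Set M), X.Finite → ∀ x, (∀ y ∈ g • X, ind X x y) →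
    ∃ s : G, Fixes s (X ∪ g • X) ∧ ∀ z ∈ insert (s • x) X, ind (g • X) (g • s • x) z

/-- Here `Q` only says that points are distinct. That keeps `a` and `k a` outside the base over
which they are independent, so their colour is one used by the amalgam. -/
theorem exists_movesBySolution [Countable M] (hg : g ≠ 1) :
    ∃ h : G, MovesBySolution M (groupCommutator h g) := by
  obtain ⟨h, hh⟩ := exists_reachesThrough (G := G) (M := M) (g := g) (Q := fun i => i ≠ E)
    (fun X hX x hx => by
      obtain ⟨s, hs, hsx⟩ := exists_moved hg hX hx
      exact ⟨s, hs, fun h => hsx (d_eq_iff.1 h).symm⟩)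
  refine ⟨h, fun X hX x hx => ?_⟩
  obtain ⟨t, ht, htx⟩ := exists_ind G x hX (hX.smul_set (a := groupCommutator h g))
  have htx' : t • x ∉ X := fun hmem => by
    have := ht.inv _ hmem
    rw [inv_smul_smul] at this
    exact hx (this ▸ hmem)
  obtain ⟨s, X', hs, -, -, hQ1, hQ2, h1, h2, -, -, h3⟩ := hh X hX (t • x) htx' htx
  refine ⟨s * t, (hs.mono Set.subset_union_left).mul ht, ?_⟩
  rw [mul_smul, d_comm]
  refine solution_of_ind h3 ?_ ?_
  · rintro (h | h)
    · exact hQ2 (d_eq_iff.2 h.symm)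
    · exact h2 h
  · rintro (h | h)
    · exact hQ1 (d_eq_iff.2 h)
    · exact h1 h

/-- Now both colours at `g a` lie in `L'`. By `ind_of_insert` this point leaves the base, and
transitivity lowers the base from `X'` to `k X`. -/
theorem MovesBySolution.exists_movesMaximally [Countable M] (hg : MovesBySolution M g) :
    ∃ h : G, MovesMaximally M (groupCommutator h g) := by
  obtain ⟨h, hh⟩ := exists_reachesThrough (G := G) (M := M) (g := g) (Q := Solution) hg
  refine ⟨h, fun X hX x hx => ?_⟩
  by_cases hxX : x ∈ X
  · exact ⟨1, fixes_one _, fun z _ => ind_of_mem_left (by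
      rw [one_smul]; exact Set.smul_mem_smul_set hxX)⟩
  obtain ⟨s, X', hs, hX', hkX', hQ1, hQ2, -, -, -, h2, h3⟩ := hh X hX x hxX hx
  refine ⟨s, hs, ?_⟩
  rintro z (rfl | hz)
  · exact ind_trans hkX' h2 (ind_of_insert h3 (by rw [d_comm]; exact hQ2)
      (by rw [d_comm]; exact hQ1))
  · exact h2 z (hX' hz)

/-- The realisation is first made independent from `g X` over `X`. Its image is then independent
from it over `X ∪ g X`, and transitivity leaves the base `X`. -/
theorem MovesMaximally.exists_ind_smul (hg : MovesMaximally M g) (hX : X.Finite) (x : M) :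
    ∃ s : G, Fixes s X ∧ ind X (s • x) (g • s • x) := by
  obtain ⟨t, ht, htx⟩ := exists_ind G x hX (hX.smul_set (a := g))
  obtain ⟨s, hs, hsx⟩ := hg X hX (t • x) htx
  have hsX := hs.mono Set.subset_union_left
  refine ⟨s * t, hsX.mul ht, ?_⟩
  rw [mul_smul]
  have h1 : Perp {s • t • x} X (g • X) := by
    rintro _ rfl y hy
    have := ind_smul s (htx y hy)
    rwa [hsX.smul_set, hs y (Or.inr hy)] at this
  have h2 : Perp {g • s • t • x} (g • X) (insert (s • t • x) X) := by
    rintro _ rfl z hz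
    exact hsx z hz
  have h3 : Perp {g • s • t • x} (X ∪ g • X) {s • t • x} :=
    (h2.right (by simp)).mono_base Set.subset_union_right
      ((h2.right (Set.subset_insert _ _)).union_right (perp_of_subset_right subset_rfl))
  exact ((perp_of_subset_right subset_rfl).union_right h1).trans Set.subset_union_left h3.symm
    _ rfl _ rfl

end Commutators

/-! ### Prescribing values of conjugates -/

section Conjugates

variable {G : Type*} {M : Type w} [Group G] [MulAction G M]

/-- `h'` is a conjugate of `h` by an element that fixes `F` pointwise. -/
def ConjFix (F : Set M) (h h' : G) : Prop := ∃ e : G, Fixes e F ∧ h' = e⁻¹ * h * e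

variable {g h h' h'' : G} {A B C F K L X W Y : Set M}

theorem ConjFix.mono (hh : ConjFix F h h') (hK : K ⊆ F) : ConjFix K h h' :=
  let ⟨e, he, h1⟩ := hh
  ⟨e, he.mono hK, h1⟩

theorem ConjFix.trans (h1 : ConjFix F h h') (h2 : ConjFix F h' h'') : ConjFix F h h'' := by
  obtain ⟨e, he, rfl⟩ := h1
  obtain ⟨e', he', rfl⟩ := h2
  exact ⟨e * e', he.mul he', by group⟩

theorem ConjFix.apply (hh : ConjFix (X ∪ h • X) h h') {x : M} (hx : x ∈ X) : h' • x = h • x := by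
  obtain ⟨e, he, rfl⟩ := hh
  rw [mul_smul, mul_smul, he x (Or.inl hx), he.inv _ (Or.inr (Set.smul_mem_smul_set hx))]

theorem ConjFix.smul_set (hh : ConjFix (X ∪ h • X) h h') (hK : K ⊆ X) : h' • K = h • K :=
  smul_set_congr fun _ hx => hh.apply (hK hx)

theorem ConjFix.inv_smul_set (hh : ConjFix (X ∪ h • X) h h') (hK : h⁻¹ • K ⊆ X) :
    h'⁻¹ • K = h⁻¹ • K := by
  rw [inv_smul_eq_iff, hh.smul_set hK, smul_inv_smul]

variable [ColourSpace M] [ColourHomogeneous G M]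

theorem MovesMaximally.conj (hg : MovesMaximally M g) (e : G) :
    MovesMaximally M (e⁻¹ * g * e) := by
  intro X hX x hx
  obtain ⟨s, hs, hsx⟩ := hg (e • X) hX.smul_set (e • x) (by
    intro y hy
    have := ind_smul e (hx (e⁻¹ • y) (by
      simp only [mul_smul]; exact Set.smul_mem_smul_set hy))
    rwa [smul_inv_smul] at this)
  refine ⟨e⁻¹ * s * e, ?_, ?_⟩
  · intro y hy
    have : e • y ∈ e • X ∪ g • e • X := by
      rcases hy with hy | hy
      · exact Or.inl (Set.smul_mem_smul_set hy)
      · have := Set.smul_mem_smul_set (a := e) hy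
        simp only [mul_smul, smul_inv_smul] at this
        exact Or.inr this
    rw [mul_smul, mul_smul, hs _ this, inv_smul_smul]
  · intro z hz
    have := ind_smul e⁻¹ (hsx (e • z) (by
      rcases hz with rfl | hz
      · exact Or.inl (by simp only [mul_smul, smul_inv_smul])
      · exact Or.inr (Set.smul_mem_smul_set hz)))
    simpa only [mul_smul, smul_inv_smul, inv_smul_smul] using this

theorem ConjFix.movesMaximally (hh : ConjFix F h h') (hm : MovesMaximally M h) :
    MovesMaximally M h' := by
  obtain ⟨e, -, rfl⟩ := hh
  exact hm.conj e

/-- Maximal movement gives one realisation `s x` with a generic image. By stationarity some `e`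
fixes `X ∪ g X` and takes `x` to `s x` and `τ x` to `g s x`; conjugation by `e` pulls this back. -/
theorem MovesMaximally.exists_conj_smul_eq (hg : MovesMaximally M g) (hX : X.Finite) {x : M}
    {τ : G} (hτ : ∀ y ∈ X, τ • y = g • y) (h1 : ∀ y ∈ g • X, ind X x y)
    (h2 : ∀ z ∈ insert x X, ind (g • X) (τ • x) z) :
    ∃ e : G, Fixes e (X ∪ g • X) ∧ (e⁻¹ * g * e) • x = τ • x := by
  obtain ⟨s, hs, hsx⟩ := hg X hX x h1
  have hρ : Fixes (g * s * τ⁻¹) (g • X) := by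
    rintro _ ⟨y, hy, rfl⟩
    dsimp only
    rw [mul_smul, mul_smul, ← hτ y hy, inv_smul_smul, hs y (Or.inl hy), hτ y hy]
  have hρx : (g * s * τ⁻¹) • τ • x = g • s • x := by
    rw [mul_smul, mul_smul, inv_smul_smul]
  obtain ⟨e, he1, he2⟩ := exists_glue (g := g * s * τ⁻¹) (h := s) (A := {τ • x}) (B := g • X)
    (C := insert x (X ∪ g • X)) (Set.finite_singleton _) ((hX.union hX.smul_set).insert x)
    (fun b hb => by rw [hρ b hb, hs b (Or.inr hb)]) (by
      rintro _ rfl z (rfl | hz | hz)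
      · exact h2 _ (Or.inl rfl)
      · exact h2 _ (Or.inr hz)
      · exact ind_of_mem_right hz) (by
      rw [hρ.smul_set, Set.smul_set_singleton, hρx]
      rintro _ rfl _ ⟨z, rfl | hz | hz, rfl⟩
      · exact hsx _ (Or.inl rfl)
      · exact hsx _ (Or.inr (by dsimp only; rwa [hs z (Or.inl hz)]))
      · exact ind_of_mem_right (by dsimp only; rwa [hs z (Or.inr hz)]))
  refine ⟨e, fun y hy => (he2 y (Or.inr hy)).trans (hs y hy), ?_⟩
  rw [mul_smul, mul_smul, he2 x (Or.inl rfl), inv_smul_eq_iff, he1 _ rfl, hρx]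

/-- The values of a conjugate of `g` on `A` can be prescribed, if they are as independent from `A`
as possible. -/
theorem MovesMaximally.exists_conj_eqOn (hg : MovesMaximally M g) (hX : X.Finite)
    (hA : A.Finite) {τ : G} (hτ : ∀ y ∈ X, τ • y = g • y) (h1 : Perp A X (g • X))
    (h2 : Perp (τ • A) (g • X) (X ∪ A)) :
    ∃ g' : G, ConjFix (X ∪ g • X) g g' ∧ ∀ a ∈ A, g' • a = τ • a := by
  induction A, hA using Set.Finite.induction_on with
  | empty => exact ⟨g, ⟨1, fixes_one _, by group⟩, by simp⟩
  | @insert x A _ hA ih =>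
    have hsub : A ⊆ insert x A := Set.subset_insert x A
    obtain ⟨g', hg', hg'A⟩ := ih (h1.left hsub)
      (h2.subset (Set.smul_set_mono hsub) (Set.union_subset_union_right X hsub))
    have hX' : g' • X = g • X := hg'.smul_set subset_rfl
    have hA' : g' • A = τ • A := smul_set_congr hg'A
    have hXA : g' • (X ∪ A) = g • X ∪ τ • A := by rw [Set.smul_set_union, hX', hA']
    -- The one-point case is applied over `X ∪ A`, whose image is `g X ∪ τ A`. This fact and the
    -- next are its two premises.
    have hxA : Perp {x} (X ∪ A) (g • X ∪ τ • A) := by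
      have e1 : Perp {x} (X ∪ A) (g • X) :=
        (Perp.mono_base (h1.left (by simp : ({x} : Set M) ⊆ insert x A)).symm
          (Set.subset_union_left (t := A)) ((perp_of_subset_right subset_rfl).union_right
            (h1.left hsub).symm)).symm
      refine e1.union_right ?_
      have e2 : Perp (τ • A) (g • X ∪ (X ∪ A)) {x} := by
        refine Perp.mono_base (h2.subset (Set.smul_set_mono hsub) (by simp))
          Set.subset_union_left ((perp_of_subset_right subset_rfl).union_right
          (h2.subset (Set.smul_set_mono hsub) (Set.union_subset_union_right X hsub)))
      exact Perp.trans (e1.union_right (perp_of_subset_right subset_rfl))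
        Set.subset_union_right e2.symm
    have hxA' : Perp {τ • x} (g • X ∪ τ • A) (X ∪ insert x A) := by
      have e1 : Perp (X ∪ insert x A) (g • X) {τ • x} :=
        (h2.left (by rintro _ rfl; exact Set.smul_mem_smul_set (Or.inl rfl))).symm
      exact (e1.mono_base Set.subset_union_left ((perp_of_subset_right subset_rfl).union_right
        (h2.left (Set.smul_set_mono hsub)).symm)).symm
    obtain ⟨e, he, hex⟩ := (hg'.movesMaximally hg).exists_conj_smul_eq (hX.union hA) (x := x)
      (τ := τ) (by
        rintro y (hy | hy)
        · rw [hτ y hy, hg'.apply hy]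
        · exact (hg'A y hy).symm)
      (fun y hy => hxA x rfl y (hXA ▸ hy)) (fun z hz => by
        rw [hXA]
        exact hxA' _ rfl z (by simpa [or_left_comm] using hz))
    have hc : ConjFix (X ∪ A ∪ g' • (X ∪ A)) g' (e⁻¹ * g' * e) := ⟨e, he, rfl⟩
    refine ⟨_, hg'.trans (hc.mono ?_), ?_⟩
    · rw [hXA]
      exact Set.union_subset_union Set.subset_union_left Set.subset_union_left
    · rintro y (rfl | hy)
      · exact hex
      · rw [hc.apply (Or.inr hy), hg'A y hy]

/-- A conjugate of `h` may take values on `A` that are independent from any given set. -/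
theorem MovesMaximally.exists_conj_free (hh : MovesMaximally M h) (hX : X.Finite) (hA : A.Finite)
    (hW : W.Finite) (hK : K ⊆ X) (h1 : Perp A K (X ∪ h • X)) :
    ∃ h' : G, ConjFix (X ∪ h • X) h h' ∧ Perp (h' • A) (h • K) W := by
  obtain ⟨ρ, hρ, hρA⟩ := exists_perp G (hA.smul_set (a := h)) (hX.smul_set (a := h))
    ((hW.union hX).union hA)
  obtain ⟨h', hh', hh'A⟩ := hh.exists_conj_eqOn hX hA (τ := ρ * h)
    (fun y hy => by rw [mul_smul, hρ _ (Set.smul_mem_smul_set hy)])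
    ((h1.right Set.subset_union_right).mono_base hK (h1.right Set.subset_union_left))
    (by
      rw [mul_smul]
      exact hρA.right (Set.union_subset_union_left _ Set.subset_union_right))
  refine ⟨h', hh', ?_⟩
  have hKX : h • K ⊆ h • X := Set.smul_set_mono hK
  have e1 := ((h1.right Set.subset_union_left).smul h).smul ρ
  rw [(hρ.mono hKX).smul_set, hρ.smul_set] at e1
  rw [smul_set_congr hh'A, mul_smul]
  exact e1.trans hKX (hρA.right (Set.subset_union_left.trans Set.subset_union_left))

/-- The inverse of a conjugate of `h` may take values on `B` that are independent from any given
set. -/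
theorem MovesMaximally.exists_conj_inv_free (hh : MovesMaximally M h) (hX : X.Finite)
    (hB : B.Finite) (hW : W.Finite) (hK : K ⊆ X) (h1 : Perp B (h • K) (X ∪ h • X)) :
    ∃ h' : G, ConjFix (X ∪ h • X) h h' ∧ Perp (h'⁻¹ • B) K W := by
  -- Maximal movement speaks of forward images only. So a generic copy of `h⁻¹ • B` over `X` is
  -- chosen first, and the conjugate is then required to map it onto `B`.
  obtain ⟨ρ, hρ, hρA⟩ := exists_perp G (hB.smul_set (a := h⁻¹)) hX
    (((hW.union (hX.smul_set (a := h))).union hB).union hX)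
  have hKX : h • K ⊆ h • X := Set.smul_set_mono hK
  have hτA : (h * ρ⁻¹) • ρ • h⁻¹ • B = B := by
    rw [mul_smul, inv_smul_smul, smul_inv_smul]
  have e0 : Perp B (h • X) X :=
    (h1.right Set.subset_union_left).mono_base hKX (h1.right Set.subset_union_right)
  have hAX : Perp (ρ • h⁻¹ • B) X (h • X) :=
    hρA.right fun y hy => Or.inl (Or.inl (Or.inr hy))
  obtain ⟨h', hh', hh'A⟩ := hh.exists_conj_eqOn (A := ρ • h⁻¹ • B) hX hB.smul_set.smul_set
    (τ := h * ρ⁻¹) (fun y hy => by rw [mul_smul, hρ.inv y hy]) hAX (by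
      rw [hτA]
      refine e0.union_right ?_
      have e1 : Perp (ρ • h⁻¹ • B) (X ∪ h • X) B :=
        (hρA.right fun y hy => Or.inl (Or.inr hy)).mono_base Set.subset_union_left
          ((perp_of_subset_right subset_rfl).union_right hAX)
      exact (e0.union_right (perp_of_subset_right subset_rfl)).trans Set.subset_union_right
        e1.symm)
  have hB' : h'⁻¹ • B = ρ • h⁻¹ • B := by
    rw [inv_smul_eq_iff, smul_set_congr hh'A, hτA]
  refine ⟨h', hh', ?_⟩
  have e1 := ((h1.right Set.subset_union_right).smul h⁻¹).smul ρ
  rw [inv_smul_smul, inv_smul_smul, (hρ.mono hK).smul_set, hρ.smul_set] at e1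
  rw [hB']
  exact e1.trans hK (hρA.right fun y hy => Or.inl (Or.inl (Or.inl hy)))

theorem exists_conjFix_perp (h : G) (hF : F.Finite) (hW : W.Finite) :
    ∃ h' : G, ConjFix F h h' ∧ Perp (F ∪ h' • F ∪ h'⁻¹ • F) F W := by
  obtain ⟨ρ, hρ, hρA⟩ := exists_perp G ((hF.union (hF.smul_set (a := h))).union
    (hF.smul_set (a := h⁻¹))) hF hW
  refine ⟨ρ * h * ρ⁻¹, ⟨ρ⁻¹, hρ.inv, by group⟩, ?_⟩
  have e1 : (ρ * h * ρ⁻¹) • F = ρ • h • F := by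
    rw [mul_smul, mul_smul, hρ.inv.smul_set]
  have e2 : (ρ * h * ρ⁻¹)⁻¹ • F = ρ • h⁻¹ • F := by
    rw [show (ρ * h * ρ⁻¹)⁻¹ = ρ * h⁻¹ * ρ⁻¹ by group, mul_smul, mul_smul, hρ.inv.smul_set]
  rwa [Set.smul_set_union, Set.smul_set_union, hρ.smul_set, ← e1, ← e2] at hρA

end Conjugates

/-! ### Products of three conjugates -/

section ThreeConjugates

variable {G : Type*} {M : Type w} [Group G] [MulAction G M] [ColourSpace M]
  [ColourHomogeneous G M] {g h₁ h₂ h₃ : G} {F Y₀ Y₁ Y₂ Y₃ Z : Set M}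

/-- After conjugation over `F`, the orbit segments `Y₀, Y₁, Y₂, Y₃` of a finite set under three
maximally moving elements can be made to contain `F` and to be in general position. -/
theorem exists_conjFix_segments (m₁ : MovesMaximally M h₁) (m₂ : MovesMaximally M h₂)
    (m₃ : MovesMaximally M h₃) (hF : F.Finite) :
    ∃ k₁ k₂ k₃ : G, ConjFix F h₁ k₁ ∧ ConjFix F h₂ k₂ ∧ ConjFix F h₃ k₃ ∧
      ∃ Y₀ Y₁ Y₂ Y₃ : Set M, Y₀.Finite ∧ k₁ • Y₀ = Y₁ ∧ k₂ • Y₁ = Y₂ ∧ k₃ • Y₂ = Y₃ ∧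
        F ⊆ Y₀ ∧ F ⊆ Y₁ ∧ F ⊆ Y₃ ∧ Perp Y₃ Y₀ Y₁ ∧ Perp Y₀ Y₃ Y₂ := by
  -- The set `Yᵢ` will consist of the points at position `i` of all orbit segments that meet `F` in
  -- one of the four positions. The pieces are built by generic forward and backward images. Each
  -- conjugation fixes the earlier domains and ranges, so earlier values survive; `Perp.chain` turns
  -- independence over an image of `F` into independence over `F`.
  have hfin : ∀ h : G, (F ∪ h • F ∪ h⁻¹ • F).Finite := fun h =>
    (hF.union hF.smul_set).union hF.smul_set
  obtain ⟨l₂, c₂, p₂⟩ := exists_conjFix_perp h₂ hF (hfin h₁)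
  obtain ⟨l₃, c₃, p₃⟩ := exists_conjFix_perp h₃ hF ((hfin h₁).union (hfin l₂))
  replace m₂ := c₂.movesMaximally m₂
  replace m₃ := c₃.movesMaximally m₃
  set S₁ := F ∪ h₁ • F ∪ h₁⁻¹ • F with hS₁
  set S₂ := F ∪ l₂ • F ∪ l₂⁻¹ • F with hS₂
  set S₃ := F ∪ l₃ • F ∪ l₃⁻¹ • F with hS₃
  have fS : ∀ h : G, F ⊆ F ∪ h • F ∪ h⁻¹ • F := fun h y hy => Or.inl (Or.inl hy)
  have iS : ∀ h : G, h • F ⊆ F ∪ h • F ∪ h⁻¹ • F := fun h y hy => Or.inl (Or.inr hy)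
  have jS : ∀ h : G, h⁻¹ • F ⊆ F ∪ h • F ∪ h⁻¹ • F := fun h y hy => Or.inr hy
  have p₃₁ : Perp S₃ F S₁ := p₃.right Set.subset_union_left
  have p₃₂ : Perp S₃ F S₂ := p₃.right Set.subset_union_right
  have dom : ∀ h : G, F ∪ h⁻¹ • F ∪ h • (F ∪ h⁻¹ • F) = F ∪ h • F ∪ h⁻¹ • F := fun h => by
    rw [Set.smul_set_union, smul_inv_smul]
    ext y; simp only [Set.mem_union]; tauto
  have fdom : ∀ h : G, (F ∪ h⁻¹ • F).Finite := fun h => hF.union hF.smul_set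
  -- forward images under the second element
  obtain ⟨k₂, d₂, q₂⟩ := m₂.exists_conj_free (X := F ∪ l₂⁻¹ • F) (A := h₁ • F) (K := F)
    (W := S₁ ∪ S₂ ∪ S₃) (fdom l₂) hF.smul_set (((hfin h₁).union (hfin l₂)).union (hfin l₃))
    Set.subset_union_left (by rw [dom]; exact p₂.symm.left (iS h₁))
  set A₂ := k₂ • h₁ • F with hA₂
  have hA₂f : A₂.Finite := hF.smul_set.smul_set
  have q₂S₁ : Perp A₂ F S₁ := Perp.chain (q₂.right fun y hy => Or.inl (Or.inl hy))
    (p₂.left (iS l₂)) (q₂.right fun y hy => Or.inl (Or.inl (fS h₁ hy)))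
  have q₂S₃ : Perp A₂ F S₃ := Perp.chain (q₂.right fun y hy => Or.inr hy)
    (p₃₂.symm.left (iS l₂)) (q₂.right fun y hy => Or.inl (Or.inl (fS h₁ hy)))
  have ek₂ : k₂ • F = l₂ • F := d₂.smul_set Set.subset_union_left
  have ek₂' : k₂⁻¹ • F = l₂⁻¹ • F := d₂.inv_smul_set Set.subset_union_right
  have ek₂'' : k₂ • l₂⁻¹ • F = F := by rw [← ek₂', smul_inv_smul]
  -- backward images under the second element
  replace m₂ := d₂.movesMaximally m₂
  obtain ⟨n₂, d₂', r₂⟩ := m₂.exists_conj_inv_free (X := F ∪ l₂⁻¹ • F ∪ h₁ • F) (B := l₃⁻¹ • F)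
    (K := l₂⁻¹ • F) (W := S₁ ∪ S₂ ∪ S₃ ∪ A₂) ((fdom l₂).union hF.smul_set) hF.smul_set
    ((((hfin h₁).union (hfin l₂)).union (hfin l₃)).union hA₂f)
    (fun y hy => Or.inl (Or.inr hy)) (by
      rw [Set.smul_set_union, Set.smul_set_union, ek₂'', ek₂]
      have e1 : Perp (l₃⁻¹ • F) F S₂ := p₃₂.left (jS l₃)
      have e2 : Perp (l₃⁻¹ • F) F (h₁ • F) := p₃₁.subset (jS l₃) (iS h₁)
      have e3 : Perp (l₃⁻¹ • F) F A₂ := (q₂S₃.right (jS l₃)).symm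
      exact (((e1.right (fS l₂)).union_right (e1.right (jS l₂))).union_right e2).union_right
        (((e1.right (iS l₂)).union_right (e1.right (fS l₂))).union_right e3))
  set B₁ := n₂⁻¹ • l₃⁻¹ • F with hB₁
  have hB₁f : B₁.Finite := hF.smul_set.smul_set
  have en₂ : n₂ • F = l₂ • F :=
    (d₂'.smul_set fun y hy => Or.inl (Or.inl hy)).trans ek₂
  have en₂' : n₂ • l₂⁻¹ • F = F :=
    (d₂'.smul_set fun y hy => Or.inl (Or.inr hy)).trans ek₂''
  have en₂'' : n₂ • h₁ • F = A₂ := d₂'.smul_set fun y hy => Or.inr hy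
  have en₂B : n₂ • B₁ = l₃⁻¹ • F := by rw [hB₁, smul_inv_smul]
  have r₂F : Perp B₁ (l₂⁻¹ • F) F := r₂.right fun y hy => Or.inl (Or.inl (Or.inl (fS h₁ hy)))
  have r₂S₁ : Perp B₁ F S₁ := Perp.chain (r₂.right fun y hy => Or.inl (Or.inl (Or.inl hy)))
    (p₂.left (jS l₂)) r₂F
  have r₂S₃ : Perp B₁ F S₃ := Perp.chain (r₂.right fun y hy => Or.inl (Or.inr hy))
    (p₃₂.symm.left (jS l₂)) r₂F
  -- forward images under the third element
  obtain ⟨k₃, d₃, q₃⟩ := m₃.exists_conj_free (X := F ∪ l₃⁻¹ • F) (A := A₂ ∪ l₂ • F) (K := F)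
    (W := S₁ ∪ S₂ ∪ S₃ ∪ A₂ ∪ B₁) (fdom l₃) (hA₂f.union hF.smul_set)
    (((((hfin h₁).union (hfin l₂)).union (hfin l₃)).union hA₂f).union hB₁f)
    Set.subset_union_left (by
      rw [dom]
      exact q₂S₃.union_left (p₃₂.symm.left (iS l₂)))
  set A₃ := k₃ • (A₂ ∪ l₂ • F) with hA₃
  have hA₃f : A₃.Finite := (hA₂f.union hF.smul_set).smul_set
  have ek₃ : k₃ • F = l₃ • F := d₃.smul_set Set.subset_union_left
  have ek₃' : k₃ • l₃⁻¹ • F = F := by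
    rw [← (d₃.inv_smul_set Set.subset_union_right : k₃⁻¹ • F = l₃⁻¹ • F), smul_inv_smul]
  have q₃F : Perp A₃ (l₃ • F) F :=
    q₃.right fun y hy => Or.inl (Or.inl (Or.inl (Or.inl (fS h₁ hy))))
  have q₃S₁ : Perp A₃ F S₁ :=
    Perp.chain (q₃.right fun y hy => Or.inl (Or.inl (Or.inl (Or.inl hy)))) (p₃₁.left (iS l₃)) q₃F
  -- backward images under the first element
  obtain ⟨k₁, d₁, r₁⟩ := m₁.exists_conj_inv_free (X := F ∪ h₁⁻¹ • F) (B := B₁ ∪ l₂⁻¹ • F)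
    (K := h₁⁻¹ • F) (W := S₁ ∪ S₂ ∪ S₃ ∪ A₂ ∪ B₁ ∪ A₃) (fdom h₁) (hB₁f.union hF.smul_set)
    ((((((hfin h₁).union (hfin l₂)).union (hfin l₃)).union hA₂f).union hB₁f).union hA₃f)
    Set.subset_union_right (by
      rw [dom, smul_inv_smul]
      exact r₂S₁.union_left (p₂.left (jS l₂)))
  set B₀ := k₁⁻¹ • (B₁ ∪ l₂⁻¹ • F) with hB₀
  have hB₀f : B₀.Finite := (hB₁f.union hF.smul_set).smul_set
  have ek₁ : k₁ • F = h₁ • F := d₁.smul_set Set.subset_union_left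
  have ek₁' : k₁ • h₁⁻¹ • F = F := by
    rw [← (d₁.inv_smul_set Set.subset_union_right : k₁⁻¹ • F = h₁⁻¹ • F), smul_inv_smul]
  have ek₁B : k₁ • B₀ = B₁ ∪ l₂⁻¹ • F := by rw [hB₀, smul_inv_smul]
  have r₁F : Perp B₀ (h₁⁻¹ • F) F :=
    r₁.right fun y hy => Or.inl (Or.inl (Or.inl (Or.inl (Or.inl (fS h₁ hy)))))
  have r₁S₂ : Perp B₀ F S₂ :=
    Perp.chain (r₁.right fun y hy => Or.inl (Or.inl (Or.inl (Or.inl (Or.inr hy)))))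
      (p₂.symm.left (jS h₁)) r₁F
  have r₁S₃ : Perp B₀ F S₃ :=
    Perp.chain (r₁.right fun y hy => Or.inl (Or.inl (Or.inl (Or.inr hy))))
      (p₃₁.symm.left (jS h₁)) r₁F
  have r₁A₂ : Perp B₀ F A₂ := Perp.chain (r₁.right fun y hy => Or.inl (Or.inl (Or.inr hy)))
    (q₂S₁.symm.left (jS h₁)) r₁F
  have r₁A₃ : Perp B₀ F A₃ := Perp.chain (r₁.right fun y hy => Or.inr hy)
    (q₃S₁.symm.left (jS h₁)) r₁F
  have q₃B₁ : Perp A₃ F B₁ := Perp.chain (q₃.right fun y hy => Or.inr hy)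
    (r₂S₃.symm.left (iS l₃)) q₃F
  have q₃l₂ : Perp A₃ F (l₂⁻¹ • F) :=
    Perp.chain (q₃.right fun y hy => Or.inl (Or.inl (Or.inl (Or.inr (jS l₂ hy)))))
      (p₃₂.subset (iS l₃) (jS l₂)) q₃F
  have FF : ∀ C : Set M, Perp F F C := fun C => perp_of_subset_left subset_rfl
  have FF' : ∀ C : Set M, Perp C F F := fun C => perp_of_subset_right subset_rfl
  refine ⟨k₁, n₂, k₃, d₁.mono fun y hy => Or.inl (Or.inl hy),
    c₂.trans ((d₂.mono fun y hy => Or.inl (Or.inl hy)).trans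
      (d₂'.mono fun y hy => Or.inl (Or.inl (Or.inl hy)))),
    c₃.trans (d₃.mono fun y hy => Or.inl (Or.inl hy)),
    h₁⁻¹ • F ∪ F ∪ B₀, F ∪ h₁ • F ∪ (B₁ ∪ l₂⁻¹ • F), l₂ • F ∪ A₂ ∪ (l₃⁻¹ • F ∪ F),
    A₃ ∪ (F ∪ l₃ • F), (hF.smul_set.union hF).union hB₀f, ?_, ?_, ?_,
    fun y hy => Or.inl (Or.inr hy), fun y hy => Or.inl (Or.inl hy),
    fun y hy => Or.inr (Or.inl hy), ?_, ?_⟩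
  · rw [Set.smul_set_union, Set.smul_set_union, ek₁', ek₁, ek₁B]
  · rw [Set.smul_set_union, Set.smul_set_union, Set.smul_set_union, en₂, en₂'', en₂B, en₂']
  · rw [Set.union_comm (l₂ • F), Set.smul_set_union, ← hA₃, Set.smul_set_union, ek₃', ek₃]
  -- All pieces involved are independent over `F`; the base is then raised to `Y₀`, which contains
  -- `F`.
  · refine Perp.mono_base (B := F) ?_ (fun y hy => Or.inl (Or.inr hy)) ?_
    · refine Perp.union_left ?_ ((FF _).union_left ?_)
      · exact ((FF' _).union_right (q₃S₁.right (iS h₁))).union_right (q₃B₁.union_right q₃l₂)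
      · refine ((FF' _).union_right (p₃₁.subset (iS l₃) (iS h₁))).union_right ?_
        exact (r₂S₃.symm.left (iS l₃)).union_right (p₃₂.subset (iS l₃) (jS l₂))
    · refine Perp.union_left ?_ ((FF _).union_left ?_)
      · exact ((q₃S₁.right (jS h₁)).union_right (FF' _)).union_right r₁A₃.symm
      · exact ((p₃₁.subset (iS l₃) (jS h₁)).union_right (FF' _)).union_right
          (r₁S₃.symm.left (iS l₃))
  · refine Perp.mono_base (B := F) ?_ (fun y hy => Or.inr (Or.inl hy)) ?_
    · refine Perp.union_left (Perp.union_left ?_ (FF _)) ?_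
      · exact ((p₂.symm.subset (jS h₁) (iS l₂)).union_right (q₂S₁.symm.left (jS h₁))).union_right
          ((p₃₁.symm.subset (jS h₁) (jS l₃)).union_right (FF' _))
      · exact ((r₁S₂.right (iS l₂)).union_right r₁A₂).union_right
          ((r₁S₃.right (jS l₃)).union_right (FF' _))
    · refine Perp.union_left (Perp.union_left ?_ (FF _)) ?_
      · exact (q₃S₁.symm.left (jS h₁)).union_right
          ((FF' _).union_right (p₃₁.symm.subset (jS h₁) (iS l₃)))
      · exact r₁A₃.union_right ((FF' _).union_right (r₁S₃.right (iS l₃)))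

/-- The first two conjugates take `Z` to generic sets over `Y₁` and `Y₂`, and the third is
prescribed to land on `σ • Z`. This needs `Z` independent from `Y₁` over `Y₀` and `σ • Z` from `Y₂`
over `Y₃`, which `hp` gives together with `i₁` and `i₂`. -/
theorem exists_conjFix_extend_of_perp (m₁ : MovesMaximally M h₁) (m₂ : MovesMaximally M h₂)
    (m₃ : MovesMaximally M h₃) (hY₀ : Y₀.Finite) (e₁ : h₁ • Y₀ = Y₁) (e₂ : h₂ • Y₁ = Y₂)
    (e₃ : h₃ • Y₂ = Y₃) (f₀ : F ⊆ Y₀) (f₁ : F ⊆ Y₁) (f₃ : F ⊆ Y₃) (i₁ : Perp Y₃ Y₀ Y₁)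
    (i₂ : Perp Y₀ Y₃ Y₂) {σ : G} (hσ : ∀ y ∈ Y₀, σ • y = h₃ • h₂ • h₁ • y) (hZ : Z.Finite)
    (hp : Perp (Y₁ ∪ Y₂) (Y₀ ∪ Y₃) (Z ∪ σ • Z)) :
    ∃ k₁ k₂ k₃ : G, ConjFix F h₁ k₁ ∧ ConjFix F h₂ k₂ ∧ ConjFix F h₃ k₃ ∧
      ∀ z ∈ Z, k₃ • k₂ • k₁ • z = σ • z := by
  have hY₁ : Y₁.Finite := e₁ ▸ hY₀.smul_set
  have hY₂ : Y₂.Finite := e₂ ▸ hY₁.smul_set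
  have hY₃ : Y₃.Finite := e₃ ▸ hY₂.smul_set
  have rr : ∀ A B : Set M, Perp A B B := fun A B => perp_of_subset_right subset_rfl
  have z₁ : Perp Z Y₀ Y₁ := (Perp.trans ((rr _ _).union_right i₁.symm) Set.subset_union_left
    (hp.subset Set.subset_union_left Set.subset_union_left)).symm
  have z₂ : Perp (σ • Z) Y₃ Y₂ :=
    (Perp.trans (i₂.symm.union_right (rr _ _)) Set.subset_union_right
      (hp.subset Set.subset_union_right Set.subset_union_right)).symm
  obtain ⟨ρ₁, hρ₁, q₁⟩ := exists_perp G (hZ.smul_set (a := h₁)) hY₁ ((hY₀.union hZ).union hY₂)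
  set τ₁ := ρ₁ * h₁ with hτ₁
  obtain ⟨k₁, c₁, hk₁⟩ := m₁.exists_conj_eqOn hY₀ hZ (τ := τ₁) (fun y hy => by
      rw [hτ₁, mul_smul, hρ₁ _ (e₁ ▸ Set.smul_mem_smul_set hy)]) (e₁ ▸ z₁) (by
      rw [e₁, hτ₁, mul_smul]
      exact q₁.right Set.subset_union_left)
  rw [← mul_smul, ← hτ₁] at q₁
  have hZ₁ : (τ₁ • Z).Finite := hZ.smul_set
  obtain ⟨ρ₂, hρ₂, q₂⟩ := exists_perp G (hZ₁.smul_set (a := h₂)) hY₂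
    ((hY₁.union hZ₁).union (hY₃.union (hZ.smul_set (a := σ))))
  set τ₂ := ρ₂ * h₂ with hτ₂
  obtain ⟨k₂, c₂, hk₂⟩ := m₂.exists_conj_eqOn hY₁ hZ₁ (τ := τ₂) (fun y hy => by
      rw [hτ₂, mul_smul, hρ₂ _ (e₂ ▸ Set.smul_mem_smul_set hy)])
    (e₂ ▸ q₁.right Set.subset_union_right) (by
      rw [e₂, hτ₂, mul_smul]
      exact q₂.right Set.subset_union_left)
  rw [← mul_smul, ← hτ₂] at q₂
  have hZ₂ : (τ₂ • τ₁ • Z).Finite := hZ₁.smul_set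
  have hτ : (σ * τ₁⁻¹ * τ₂⁻¹) • τ₂ • τ₁ • Z = σ • Z := by
    rw [mul_smul, mul_smul, inv_smul_smul, inv_smul_smul]
  have z₃ : Perp (τ₂ • τ₁ • Z) Y₂ (Y₃ ∪ σ • Z) := q₂.right Set.subset_union_right
  obtain ⟨k₃, c₃, hk₃⟩ := m₃.exists_conj_eqOn hY₂ hZ₂ (τ := σ * τ₁⁻¹ * τ₂⁻¹) (by
      rw [← e₂, ← e₁]
      rintro _ ⟨_, ⟨y, hy, rfl⟩, rfl⟩
      have hy₁ : h₁ • y ∈ Y₁ := e₁ ▸ Set.smul_mem_smul_set hy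
      have hy₂ : h₂ • h₁ • y ∈ Y₂ := e₂ ▸ Set.smul_mem_smul_set hy₁
      have h1 : τ₁⁻¹ • h₁ • y = y := by
        rw [inv_smul_eq_iff, hτ₁, mul_smul, hρ₁ _ hy₁]
      have h2 : τ₂⁻¹ • h₂ • h₁ • y = h₁ • y := by
        rw [inv_smul_eq_iff, hτ₂, mul_smul, hρ₂ _ hy₂]
      dsimp only
      rw [mul_smul, mul_smul, h2, h1, hσ y hy])
    (e₃ ▸ z₃.right Set.subset_union_left) (by
      rw [hτ, e₃]
      refine z₂.union_right ?_
      have e : Perp (τ₂ • τ₁ • Z) (Y₂ ∪ Y₃) (σ • Z) :=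
        (z₃.right Set.subset_union_right).mono_base Set.subset_union_left
          ((rr _ _).union_right (z₃.right Set.subset_union_left))
      exact (z₂.union_right (rr _ _)).trans Set.subset_union_right e.symm)
  refine ⟨k₁, k₂, k₃, c₁.mono fun y hy => Or.inl (f₀ hy), c₂.mono fun y hy => Or.inl (f₁ hy),
    c₃.mono fun y hy => Or.inr (e₃ ▸ f₃ hy), fun z hz => ?_⟩
  have h1 : τ₁ • z ∈ τ₁ • Z := Set.smul_mem_smul_set hz
  rw [hk₁ z hz, hk₂ _ h1, hk₃ _ (Set.smul_mem_smul_set h1), mul_smul, mul_smul, inv_smul_smul,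
    inv_smul_smul]

/-- If the orbit segments are in general position, every automorphism that agrees with the product
on `Y₀` is a limit of products of conjugates over `F`. -/
theorem exists_conjFix_extend (m₁ : MovesMaximally M h₁) (m₂ : MovesMaximally M h₂)
    (m₃ : MovesMaximally M h₃) (hY₀ : Y₀.Finite) (e₁ : h₁ • Y₀ = Y₁) (e₂ : h₂ • Y₁ = Y₂)
    (e₃ : h₃ • Y₂ = Y₃) (f₀ : F ⊆ Y₀) (f₁ : F ⊆ Y₁) (f₃ : F ⊆ Y₃) (i₁ : Perp Y₃ Y₀ Y₁)
    (i₂ : Perp Y₀ Y₃ Y₂) {σ : G} (hσ : ∀ y ∈ Y₀, σ • y = h₃ • h₂ • h₁ • y) (hZ : Z.Finite) :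
    ∃ k₁ k₂ k₃ : G, ConjFix F h₁ k₁ ∧ ConjFix F h₂ k₂ ∧ ConjFix F h₃ k₃ ∧
      ∀ z ∈ Z, k₃ • k₂ • k₁ • z = σ • z := by
  have hY₁ : Y₁.Finite := e₁ ▸ hY₀.smul_set
  have hY₂ : Y₂.Finite := e₂ ▸ hY₁.smul_set
  have hY₃ : Y₃.Finite := e₃ ▸ hY₂.smul_set
  -- Conjugating all three elements by `τ` replaces `Y₁` and `Y₂` by generic copies. The product on
  -- `Y₀` is unchanged, as `τ` fixes `Y₀` and `Y₃`.
  obtain ⟨τ, hτ, hp⟩ := exists_perp G (hY₁.union hY₂) (hY₀.union hY₃)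
    (hZ.union (hZ.smul_set (a := σ)))
  have hτ₀ : Fixes τ Y₀ := hτ.mono Set.subset_union_left
  have hτ₃ : Fixes τ Y₃ := hτ.mono Set.subset_union_right
  have conj : ∀ h : G, ConjFix F h (τ * h * τ⁻¹) := fun h =>
    ⟨τ⁻¹, (hτ₀.mono f₀).inv, by group⟩
  have ee : ∀ (h : G) (Y : Set M), (τ * h * τ⁻¹) • τ • Y = τ • h • Y := fun h Y => by
    rw [mul_smul, mul_smul, inv_smul_smul]
  obtain ⟨k₁, k₂, k₃, c₁, c₂, c₃, hk⟩ := exists_conjFix_extend_of_perp (F := F)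
    (Y₁ := τ • Y₁) (Y₂ := τ • Y₂) (Y₃ := Y₃) ((conj h₁).movesMaximally m₁)
    ((conj h₂).movesMaximally m₂) ((conj h₃).movesMaximally m₃) hY₀
    (by have := ee h₁ Y₀; rwa [hτ₀.smul_set, e₁] at this) (by rw [ee, e₂])
    (by rw [ee, e₃, hτ₃.smul_set]) f₀
    (by rw [← (hτ₀.mono f₀).smul_set]; exact Set.smul_set_mono f₁) f₃
    (by have := i₁.smul τ; rwa [hτ₀.smul_set, hτ₃.smul_set] at this)
    (by have := i₂.smul τ; rwa [hτ₀.smul_set, hτ₃.smul_set] at this)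
    (σ := σ) (fun y hy => by
      have h1 : h₃ • h₂ • h₁ • y ∈ Y₃ := by
        rw [← e₃, ← e₂, ← e₁]
        exact Set.smul_mem_smul_set (Set.smul_mem_smul_set (Set.smul_mem_smul_set hy))
      simp only [mul_smul, inv_smul_smul]
      rw [hτ₀.inv y hy, hτ₃ _ h1, hσ y hy]) hZ
    (by rwa [← Set.smul_set_union])
  exact ⟨k₁, k₂, k₃, (conj h₁).trans c₁, (conj h₂).trans c₂, (conj h₃).trans c₃, hk⟩

end ThreeConjugates

/-! ### Normal subgroups -/

section Normal

variable {G : Type*} {M : Type w} [Group G] [MulAction G M]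

/-- The product of the conjugates of `g` by `a 2`, `a 1` and `a 0`. -/
def conjProd (g : G) (a : Fin 3 → G) : G :=
  (a 2)⁻¹ * g * a 2 * ((a 1)⁻¹ * g * a 1 * ((a 0)⁻¹ * g * a 0))

theorem conjProd_smul (g : G) (a : Fin 3 → G) (x : M) : conjProd g a • x =
    ((a 2)⁻¹ * g * a 2) • ((a 1)⁻¹ * g * a 1) • ((a 0)⁻¹ * g * a 0) • x := by
  rw [conjProd, mul_smul _ _ x, mul_smul _ _ x]

/-- The triples `a` and `a'` agree on `F`. -/
def Agree (F : Set M) (a a' : Fin 3 → G) : Prop := ∀ i, ∀ x ∈ F, a' i • x = a i • x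

variable {g : G} {a a' a'' : Fin 3 → G} {F F' Y Y' : Set M} {θ θ' : G}

theorem Agree.mono (h : Agree F a a') (hF : F' ⊆ F) : Agree F' a a' :=
  fun i x hx => h i x (hF hx)

theorem Agree.trans (h : Agree F a a') (h' : Agree F a' a'') : Agree F a a'' :=
  fun i x hx => (h' i x hx).trans (h i x hx)

/-- Every element that agrees with `θ` on `Y` is a limit of products of conjugates of `g` by
triples that agree with `a` on `F`. -/
def DenseNear (g : G) (a : Fin 3 → G) (F : Set M) (θ : G) (Y : Set M) : Prop :=
  ∀ σ : G, (∀ y ∈ Y, σ • y = θ • y) → ∀ Z : Set M, Z.Finite →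
    ∃ a', Agree F a a' ∧ ∀ z ∈ Z, conjProd g a' • z = σ • z

theorem DenseNear.congr (h : DenseNear g a F θ Y) (hY : Y ⊆ Y')
    (hθ : ∀ y ∈ Y, θ' • y = θ • y) : DenseNear g a F θ' Y' :=
  fun σ hσ => h σ fun y hy => (hσ y (hY hy)).trans (hθ y hy)

/-- Continuity of the product: the value of `a⁻¹ g a` at `x` is determined by `a` at `x` and at that
value. -/
theorem exists_agree_conjProd_eq (g : G) (a : Fin 3 → G) (hY : Y.Finite) :
    ∃ F : Set M, F.Finite ∧ ∀ a', Agree F a a' → ∀ y ∈ Y, conjProd g a' • y = conjProd g a • y := by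
  set h₀ := (a 0)⁻¹ * g * a 0 with e₀
  set h₁ := (a 1)⁻¹ * g * a 1 with e₁
  set h₂ := (a 2)⁻¹ * g * a 2 with e₂
  refine ⟨Y ∪ h₀ • Y ∪ h₁ • h₀ • Y ∪ h₂ • h₁ • h₀ • Y,
    ((hY.union hY.smul_set).union hY.smul_set.smul_set).union hY.smul_set.smul_set.smul_set,
    fun a' ha y hy => ?_⟩
  have key : ∀ i, ∀ x, x ∈ Y ∪ h₀ • Y ∪ h₁ • h₀ • Y ∪ h₂ • h₁ • h₀ • Y →
      ((a i)⁻¹ * g * a i) • x ∈ Y ∪ h₀ • Y ∪ h₁ • h₀ • Y ∪ h₂ • h₁ • h₀ • Y →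
      ((a' i)⁻¹ * g * a' i) • x = ((a i)⁻¹ * g * a i) • x := by
    intro i x h1 h2
    have h3 := ha i _ h2
    simp only [mul_smul, smul_inv_smul] at h3 ⊢
    rw [ha i x h1, inv_smul_eq_iff, h3]
  have m₀ : h₀ • y ∈ h₀ • Y := Set.smul_mem_smul_set hy
  have m₁ : h₁ • h₀ • y ∈ h₁ • h₀ • Y := Set.smul_mem_smul_set m₀
  have m₂ : h₂ • h₁ • h₀ • y ∈ h₂ • h₁ • h₀ • Y := Set.smul_mem_smul_set m₁
  rw [conjProd_smul, conjProd_smul,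
    key 0 y (Or.inl (Or.inl (Or.inl hy))) (Or.inl (Or.inl (Or.inr m₀))), ← e₀,
    key 1 _ (Or.inl (Or.inl (Or.inr m₀))) (Or.inl (Or.inr m₁)), ← e₁,
    key 2 _ (Or.inl (Or.inr m₁)) (Or.inr m₂)]

theorem exists_agree_of_conjFix {k : Fin 3 → G}
    (h : ∀ i, ConjFix F ((a i)⁻¹ * g * a i) (k i)) :
    ∃ a', Agree F a a' ∧ ∀ i, (a' i)⁻¹ * g * a' i = k i := by
  choose e he hk using h
  exact ⟨fun i => a i * e i, fun i x hx => by rw [mul_smul, he i x hx],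
    fun i => by rw [hk i]; group⟩

theorem Agree.inv_mem {V : Set M} (h : Agree F a a') {i : Fin 3}
    (hF : ∀ x ∈ V, (a i)⁻¹ • x ∈ F) : ∀ x ∈ V, (a' i)⁻¹ • x ∈ F := by
  intro x hx
  have := h i _ (hF x hx)
  rw [smul_inv_smul, ← eq_inv_smul_iff] at this
  exact this ▸ hF x hx

theorem exists_superset_of_monotone {S : ℕ → Set M} (hS : Monotone S)
    (hx : ∀ x, ∃ n, x ∈ S n) (hF : F.Finite) : ∃ n, F ⊆ S n := by
  induction F, hF using Set.Finite.induction_on with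
  | empty => exact ⟨0, Set.empty_subset _⟩
  | @insert x F _ _ ih =>
    obtain ⟨n, hn⟩ := ih
    obtain ⟨m, hm⟩ := hx x
    exact ⟨max n m, Set.insert_subset (hS (le_max_right _ _) hm)
      (hn.trans (hS (le_max_left _ _)))⟩

variable [ColourSpace M] [ColourHomogeneous G M]

/-- A conjugate of `a⁻¹ g a` over `F` is a conjugate of `g` by an element that agrees with `a` on
`F`. So the triple can be adjusted to put the segments in general position, and
`exists_conjFix_extend` is then density near the product. -/
theorem MovesMaximally.exists_denseNear (hg : MovesMaximally M g) (a : Fin 3 → G)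
    (hF : F.Finite) : ∃ a', ∃ Y : Set M, Agree F a a' ∧ Y.Finite ∧
      DenseNear g a' F (conjProd g a') Y := by
  obtain ⟨k₁, k₂, k₃, c₁, c₂, c₃, Y₀, Y₁, Y₂, Y₃, hY₀, e₁, e₂, e₃, f₀, f₁, f₃, i₁, i₂⟩ :=
    exists_conjFix_segments (hg.conj (a 0)) (hg.conj (a 1)) (hg.conj (a 2)) hF
  obtain ⟨a', ha', hk⟩ := exists_agree_of_conjFix (a := a) (k := ![k₁, k₂, k₃]) (F := F) (g := g)
    (by intro i; fin_cases i <;> assumption)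
  refine ⟨a', Y₀, ha', hY₀, fun σ hσ Z hZ => ?_⟩
  have h0 : (a' 0)⁻¹ * g * a' 0 = k₁ := hk 0
  have h1 : (a' 1)⁻¹ * g * a' 1 = k₂ := hk 1
  have h2 : (a' 2)⁻¹ * g * a' 2 = k₃ := hk 2
  rw [conjProd, h0, h1, h2] at hσ
  obtain ⟨n₁, n₂, n₃, d₁, d₂, d₃, hn⟩ := exists_conjFix_extend (F := F)
    (h0 ▸ hg.conj (a' 0)) (h1 ▸ hg.conj (a' 1)) (h2 ▸ hg.conj (a' 2)) hY₀ e₁ e₂ e₃ f₀ f₁ f₃ i₁ i₂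
    (σ := σ) (fun y hy => by rw [hσ y hy, mul_smul, mul_smul]) hZ
  obtain ⟨a'', ha'', hk'⟩ := exists_agree_of_conjFix (a := a') (k := ![n₁, n₂, n₃]) (F := F)
    (g := g) (by
      intro i
      fin_cases i
      · change ConjFix F ((a' 0)⁻¹ * g * a' 0) n₁; rwa [h0]
      · change ConjFix F ((a' 1)⁻¹ * g * a' 1) n₂; rwa [h1]
      · change ConjFix F ((a' 2)⁻¹ * g * a' 2) n₃; rwa [h2])
  refine ⟨a'', ha'', fun z hz => ?_⟩
  have h0 : (a'' 0)⁻¹ * g * a'' 0 = n₁ := hk' 0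
  have h1 : (a'' 1)⁻¹ * g * a'' 1 = n₂ := hk' 1
  have h2 : (a'' 2)⁻¹ * g * a'' 2 = n₃ := hk' 2
  rw [conjProd, h0, h1, h2, mul_smul, mul_smul, hn z hz]

/-- With empty segments general position is vacuous. This starts the back-and-forth. -/
theorem MovesMaximally.denseNear_empty (hg : MovesMaximally M g) (θ : G) :
    DenseNear g (1 : Fin 3 → G) (∅ : Set M) θ ∅ := by
  intro σ _ Z hZ
  have hp : ∀ A B : Set M, Perp ∅ A B := fun A B a ha => ha.elim
  obtain ⟨n₁, n₂, n₃, d₁, d₂, d₃, hn⟩ := exists_conjFix_extend (F := ∅) (Y₀ := ∅) (Y₁ := ∅)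
    (Y₂ := ∅) (Y₃ := ∅) hg hg hg Set.finite_empty Set.smul_set_empty Set.smul_set_empty
    Set.smul_set_empty subset_rfl subset_rfl subset_rfl (hp _ _) (hp _ _) (σ := σ) (by simp) hZ
  obtain ⟨a', ha', hk⟩ := exists_agree_of_conjFix (a := 1) (k := ![n₁, n₂, n₃]) (F := (∅ : Set M))
    (g := g) (by
      intro i
      simp only [Pi.one_apply, inv_one, one_mul, mul_one]
      fin_cases i <;> assumption)
  refine ⟨a', ha', fun z hz => ?_⟩
  have h0 : (a' 0)⁻¹ * g * a' 0 = n₁ := hk 0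
  have h1 : (a' 1)⁻¹ * g * a' 1 = n₂ := hk 1
  have h2 : (a' 2)⁻¹ * g * a' 2 = n₃ := hk 2
  rw [conjProd, h0, h1, h2, mul_smul, mul_smul, hn z hz]

/-- A stage in the construction of two triples `a` and `b` with
`conjProd g a = f * conjProd g b`. -/
structure Stage (G : Type*) (M : Type w) where
  a : Fin 3 → G
  b : Fin 3 → G
  A : Set M
  B : Set M
  θ : G
  Y : Set M

/-- Both families of products are dense near `θ`. -/
structure Stage.Good (g f : G) (s : Stage G M) : Prop where
  finA : s.A.Finite
  finB : s.B.Finite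
  finY : s.Y.Finite
  denseA : DenseNear g s.a s.A s.θ s.Y
  denseB : DenseNear g s.b s.B (f⁻¹ * s.θ) s.Y

/-- `s'` refines `s`, and takes care of the points of `V`. -/
structure Stage.Refines (g f : G) (V : Set M) (s s' : Stage G M) : Prop where
  subA : s.A ⊆ s'.A
  subB : s.B ⊆ s'.B
  agreeA : Agree s.A s.a s'.a
  agreeB : Agree s.B s.b s'.b
  memA : V ⊆ s'.A
  memB : V ⊆ s'.B
  invA : ∀ i, ∀ x ∈ V, (s'.a i)⁻¹ • x ∈ s'.A
  invB : ∀ i, ∀ x ∈ V, (s'.b i)⁻¹ • x ∈ s'.B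
  eqOn : ∀ x ∈ V, conjProd g s'.a • x = f • conjProd g s'.b • x

theorem MovesMaximally.exists_denseNear_of_le (hg : MovesMaximally M g) (a : Fin 3 → G)
    (hF : F.Finite) (hY : Y.Finite) {V : Set M} (hV : V.Finite) : ∃ a', ∃ F' Y' : Set M,
      F ⊆ F' ∧ V ⊆ F' ∧ F'.Finite ∧ Y'.Finite ∧ Agree F a a' ∧
      (∀ i, ∀ x ∈ V, (a' i)⁻¹ • x ∈ F') ∧ (∀ y ∈ Y, conjProd g a' • y = conjProd g a • y) ∧
      DenseNear g a' F' (conjProd g a') Y' := by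
  obtain ⟨C, hC, hCY⟩ := exists_agree_conjProd_eq g a hY
  set F' : Set M := F ∪ C ∪ V ∪ ⋃ i, (a i)⁻¹ • V with hF'
  have hF'f : F'.Finite := ((hF.union hC).union hV).union
    (Set.finite_iUnion fun i => hV.smul_set)
  obtain ⟨a', Y', ha', hY', hd⟩ := hg.exists_denseNear a hF'f
  exact ⟨a', F', Y', fun y hy => Or.inl (Or.inl (Or.inl hy)), fun y hy => Or.inl (Or.inr hy),
    hF'f, hY', ha'.mono fun y hy => Or.inl (Or.inl (Or.inl hy)),
    fun i => ha'.inv_mem fun x hx =>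
      Or.inr (Set.mem_iUnion.2 ⟨i, Set.smul_mem_smul_set hx⟩),
    hCY a' (ha'.mono fun y hy => Or.inl (Or.inl (Or.inr hy))), hd⟩

/-- One round of back-and-forth. Density gives a triple with product `θ` on `Y`, which is improved
to `a₂`, dense near its own product. Density on the other side matches `f⁻¹` times that product on
`Y₂ ∪ Y ∪ V`, and that triple is improved to `b₂`. The new centre `f * conjProd g b₂` agrees with
the product of `a₂` on `Y₂`, so both families are dense near it. -/
theorem Stage.Good.exists_refines (hg : MovesMaximally M g) {f : G} {s : Stage G M}
    (hs : s.Good g f) {V : Set M} (hV : V.Finite) :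
    ∃ s' : Stage G M, s'.Good g f ∧ s.Refines g f V s' := by
  obtain ⟨a₁, ha₁, hφ₁⟩ := hs.denseA s.θ (fun _ _ => rfl) s.Y hs.finY
  obtain ⟨a₂, A', Y₂, hA, hVA, hA', hY₂, ha₂, hia, hφ₂, hd₂⟩ :=
    hg.exists_denseNear_of_le a₁ hs.finA hs.finY hV
  obtain ⟨b₁, hb₁, hψ₁⟩ := hs.denseB (f⁻¹ * conjProd g a₂)
    (fun y hy => by rw [mul_smul, mul_smul, hφ₂ y hy, hφ₁ y hy]) (Y₂ ∪ s.Y ∪ V)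
    ((hY₂.union hs.finY).union hV)
  obtain ⟨b₂, B', Y₃, hB, hVB, hB', hY₃, hb₂, hib, hψ₂, hd₃⟩ :=
    hg.exists_denseNear_of_le b₁ hs.finB ((hY₂.union hs.finY).union hV) hV
  have hψ : ∀ y ∈ Y₂ ∪ s.Y ∪ V, f • conjProd g b₂ • y = conjProd g a₂ • y := fun y hy => by
    rw [hψ₂ y hy, hψ₁ y hy, mul_smul, smul_inv_smul]
  refine ⟨⟨a₂, b₂, A', B', f * conjProd g b₂, Y₃ ∪ Y₂⟩, ⟨hA', hB', hY₃.union hY₂, ?_, ?_⟩,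
    ⟨hA, hB, ha₁.trans ha₂, hb₁.trans hb₂, hVA, hVB, hia, hib,
      fun x hx => (hψ x (Or.inr hx)).symm⟩⟩
  · exact hd₂.congr Set.subset_union_right fun y hy => by
      rw [mul_smul, hψ y (Or.inl (Or.inl hy))]
  · exact hd₃.congr Set.subset_union_left fun y _ => by rw [inv_mul_cancel_left]

theorem exists_agree_limit (a : ℕ → Fin 3 → G) (S : ℕ → Set M) (hS : Monotone S)
    (hx : ∀ x, ∃ n, x ∈ S n) (hy : ∀ i y, ∃ n, (a n i)⁻¹ • y ∈ S n)
    (ha : ∀ n, Agree (S n) (a n) (a (n + 1))) (g : G) :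
    ∃ l : Fin 3 → G, ∀ x : M, ∃ N, ∀ n, N ≤ n → conjProd g (a n) • x = conjProd g l • x := by
  have := fun i => exists_limit (fun n => a n i) S hS hx (hy i) (fun n => ha n i)
  choose l hl using this
  refine ⟨l, fun x => ?_⟩
  obtain ⟨F, hF, hFx⟩ := exists_agree_conjProd_eq (M := M) g l (Set.finite_singleton x)
  obtain ⟨N, hN⟩ := exists_superset_of_monotone hS hx hF
  exact ⟨N, fun n hn => hFx _ (fun i y hy => (hl i n y (hS hn (hN hy))).symm) x rfl⟩

/-- If `g` moves maximally, then every element is a product of three conjugates of `g` and of the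
inverses of three conjugates of `g`. -/
theorem MovesMaximally.exists_conjProd_eq [Countable M] (hg : MovesMaximally M g) (f : G) :
    ∃ a b : Fin 3 → G, conjProd g a = f * conjProd g b := by
  have := nonempty_of_homogeneous G M
  obtain ⟨x, hx⟩ := exists_surjective_nat M
  obtain ⟨s, hs⟩ := exists_seq_of_step (Stage.Good (M := M) g f) ⟨1, 1, ∅, ∅, 1, ∅⟩
    ⟨Set.finite_empty, Set.finite_empty, Set.finite_empty, hg.denseNear_empty _,
      hg.denseNear_empty _⟩
    (fun n => Stage.Refines g f (x '' Set.Iic n))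
    (fun n s hs => hs.exists_refines hg ((Set.finite_Iic n).image x))
  have hr := fun n => (hs n).2
  have hmem : ∀ n, x n ∈ x '' Set.Iic n := fun n => ⟨n, Set.self_mem_Iic, rfl⟩
  obtain ⟨a, ha⟩ := exists_agree_limit (fun n => (s n).a) (fun n => (s n).A)
    (monotone_nat_of_le_succ fun n => (hr n).subA)
    (fun y => by obtain ⟨n, rfl⟩ := hx y; exact ⟨n + 1, (hr n).memA (hmem n)⟩)
    (fun i y => by obtain ⟨n, rfl⟩ := hx y; exact ⟨n + 1, (hr n).invA i _ (hmem n)⟩)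
    (fun n => (hr n).agreeA) g
  obtain ⟨b, hb⟩ := exists_agree_limit (fun n => (s n).b) (fun n => (s n).B)
    (monotone_nat_of_le_succ fun n => (hr n).subB)
    (fun y => by obtain ⟨n, rfl⟩ := hx y; exact ⟨n + 1, (hr n).memB (hmem n)⟩)
    (fun i y => by obtain ⟨n, rfl⟩ := hx y; exact ⟨n + 1, (hr n).invB i _ (hmem n)⟩)
    (fun n => (hr n).agreeB) g
  refine ⟨a, b, ColourHomogeneous.faithful _ _ fun y : M => ?_⟩
  obtain ⟨n, rfl⟩ := hx y
  obtain ⟨N₁, h₁⟩ := ha (x n)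
  obtain ⟨N₂, h₂⟩ := hb (x n)
  -- The refinement at step `m` concerns stage `m + 1`, where the two products agree, up to `f`, at
  -- `x 0, …, x m`.
  set m := max n (max N₁ N₂) with hm
  have l1 : n ≤ m := le_max_left _ _
  have l2 : N₁ ≤ m + 1 := (le_max_left N₁ N₂).trans ((le_max_right _ _).trans (Nat.le_succ m))
  have l3 : N₂ ≤ m + 1 := (le_max_right N₁ N₂).trans ((le_max_right _ _).trans (Nat.le_succ m))
  rw [← h₁ _ l2, mul_smul, ← h₂ _ l3]
  exact (hr m).eqOn _ ⟨n, l1, rfl⟩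

theorem conjProd_mem {N : Subgroup G} [hN : N.Normal] (hg : g ∈ N) (a : Fin 3 → G) :
    conjProd g a ∈ N := by
  have : ∀ e : G, e⁻¹ * g * e ∈ N := fun e => by simpa using hN.conj_mem g hg e⁻¹
  exact N.mul_mem (this _) (N.mul_mem (this _) (this _))

theorem groupCommutator_mem {N : Subgroup G} [hN : N.Normal] (hg : g ∈ N) (h : G) :
    groupCommutator h g ∈ N := by
  have : h⁻¹ * g⁻¹ * h ∈ N := by simpa using hN.conj_mem _ (N.inv_mem hg) h⁻¹
  exact N.mul_mem this hg

theorem exists_commutator_movesMaximally [Countable M] (hg : g ≠ 1) :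
    ∃ k h : G, MovesMaximally M (groupCommutator k (groupCommutator h g)) := by
  obtain ⟨h, hh⟩ := exists_movesBySolution (M := M) hg
  obtain ⟨k, hk⟩ := hh.exists_movesMaximally
  exact ⟨k, h, hk⟩

theorem isSimpleGroup_of_homogeneous (G : Type*) (M : Type w) [Group G] [MulAction G M]
    [ColourSpace M] [ColourHomogeneous G M] [Countable M] : IsSimpleGroup G where
  exists_pair_ne := by
    obtain ⟨m⟩ := nonempty_of_homogeneous G M
    obtain ⟨n, hn, -⟩ := exists_red_green G m Set.finite_empty
    obtain ⟨g, -, hg⟩ := exists_fixes_smul_eq G (x := m) (a := n) Set.finite_empty (by simp)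
    refine ⟨g, 1, fun h => ?_⟩
    rw [h, one_smul] at hg
    rw [hg, d_self] at hn
    cases hn
  eq_bot_or_eq_top_of_normal := by
    intro N hN
    refine or_iff_not_imp_left.2 fun hbot => ?_
    obtain ⟨⟨g, hgN⟩, hg'⟩ := Subgroup.ne_bot_iff_exists_ne_one.1 hbot
    have hg : g ≠ 1 := fun h => hg' (Subtype.ext h)
    obtain ⟨k, h, hk⟩ := exists_commutator_movesMaximally (M := M) hg
    refine (Subgroup.eq_top_iff' N).2 fun f => ?_
    obtain ⟨a, b, hab⟩ := hk.exists_conjProd_eq f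
    have hm := groupCommutator_mem (groupCommutator_mem hgN h) k
    rw [eq_mul_inv_of_mul_eq hab.symm]
    exact N.mul_mem (conjProd_mem hm a) (N.inv_mem (conjProd_mem hm b))

end Normal

/-! ### Structures in the language of colours -/

instance : DecidableEq Colour := fun i j => by
  cases i <;> cases j <;> first | exact isTrue rfl | exact isFalse (by rintro ⟨⟩)

instance : Fintype Colour :=
  ⟨{Colour.R, Colour.G, Colour.X, Colour.Y}, fun i => by cases i <;> decide⟩

/-- The colour of a pair of distinct points. -/
def Colour.hue : Colour → Hue
  | .R => Hue.R
  | .G => Hue.G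
  | .X => Hue.X
  | .Y => Hue.Y

open ColouredTriangles.Colour (hue)

theorem hue_ne_eq : ∀ i : Colour, hue i ≠ E := by decide

theorem hue_injective : Function.Injective hue := by decide

theorem exists_hue_eq : ∀ {i : Hue}, i ≠ E → ∃ k, hue k = i := by decide

theorem tri_hue_iff (i j k : Colour) :
    tri (hue i) (hue j) (hue k) ↔ ({i, j, k} : Multiset Colour) ∉ S26 := by
  simp only [S26, Set.mem_insert_iff, Set.mem_singleton_iff]
  revert i j k
  decide

/-- The colour function of `M` describes its relations. -/
class IsColouring (M : Type w) [L26.Structure M] [ColourSpace M] : Prop where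
  hasColour_iff : ∀ (i : Colour) (a b : M), HasColour i a b ↔ d a b = hue i

section Dictionary

variable {M : Type w} [L26.Structure M] [ColourSpace M] [IsColouring M]

open ColouredTriangles.IsColouring (hasColour_iff)

theorem d_eq_d_iff {N : Type*} [L26.Structure N] [ColourSpace N] [IsColouring N] {a b : M}
    {a' b' : N} : d a b = d a' b' ↔ ((a = b ↔ a' = b') ∧
      ∀ i : Colour, HasColour i a b ↔ HasColour i a' b') := by
  constructor
  · intro h
    refine ⟨by rw [← d_eq_iff, h, d_eq_iff], fun i => by rw [hasColour_iff, hasColour_iff, h]⟩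
  · rintro ⟨h1, h2⟩
    by_cases h : d a b = E
    · rw [h, eq_comm, d_eq_iff, ← h1, ← d_eq_iff, h]
    · obtain ⟨k, hk⟩ := exists_hue_eq h
      have := (h2 k).1 ((hasColour_iff k a b).2 hk.symm)
      rw [(hasColour_iff k a' b').1 this, hk]

theorem isComplete_of_colouring : IsComplete Colour M where
  irrefl i a h := by
    rw [hasColour_iff, d_self] at h
    exact hue_ne_eq i h.symm
  symm i a b h := by
    rw [hasColour_iff] at h ⊢
    rw [d_comm, h]
  exactly_one a b hab := by
    obtain ⟨k, hk⟩ := exists_hue_eq fun h => hab (d_eq_iff.1 h)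
    refine ⟨k, (hasColour_iff k a b).2 hk.symm, fun j hj => hue_injective ?_⟩
    rw [hk, (hasColour_iff j a b).1 hj]

theorem omitsTriangles_of_colouring : OmitsTriangles S26 M := by
  intro a b c _ _ _ i j k hi hj hk
  have := d_tri a b c
  rw [hasColour_iff] at hi hj hk
  rwa [hi, hj, hk, tri_hue_iff] at this

theorem allowed_iff {B : Set M} {a c : M} (ha : a ∉ B) (hc : c ∉ B) (k : Colour) :
    Allowed S26 B a c k ↔ ∀ b ∈ B, tri (d a b) (d b c) (hue k) := by
  refine forall₂_congr fun b hb => ?_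
  obtain ⟨i, hi⟩ := exists_hue_eq fun h => ha ((d_eq_iff.1 h : a = b) ▸ hb)
  obtain ⟨j, hj⟩ := exists_hue_eq fun h => hc ((d_eq_iff.1 h : b = c) ▸ hb)
  constructor
  · intro h
    rw [← hi, ← hj, tri_hue_iff]
    exact h i j ((hasColour_iff _ _ _).2 hi.symm) ((hasColour_iff _ _ _).2 hj.symm)
  · intro h i' j' hi' hj'
    rw [hasColour_iff] at hi' hj'
    rwa [hi', hj', tri_hue_iff] at h

/-- For colours other than E, `comp` is undefined exactly when G is allowed. Otherwise its value is
R, or Y if R is excluded as well. That the actual colour of `(a, c)` is allowed over all of `B`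
holds in any structure omitting `S`. -/
theorem exists_priority_iff {B : Set M} {a c : M} (ha : a ∉ B) (hc : c ∉ B) :
    (∃ i : Fin 3, Allowed S26 B a c (order26 i) ∧ (∀ j < i, ¬ Allowed S26 B a c (order26 j)) ∧
      HasColour (order26 i) a c) ↔ ind B a c := by
  have hne : ∀ b ∈ B, d a b ≠ E ∧ d b c ≠ E := fun b hb =>
    ⟨fun h => ha ((d_eq_iff.1 h : a = b) ▸ hb), fun h => hc ((d_eq_iff.1 h : b = c) ▸ hb)⟩
  simp only [allowed_iff ha hc, hasColour_iff]
  have e0 : hue (order26 0) = Hue.G := rfl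
  have e1 : hue (order26 1) = Hue.R := rfl
  have e2 : hue (order26 2) = Hue.Y := rfl
  have kG : ∀ i j : Hue, i ≠ E → j ≠ E → (tri i j Hue.G ↔ comp i j = none) := by decide
  have kRY : ∀ i j : Hue, i ≠ E → j ≠ E → ∀ u, ¬ tri i j Hue.G → tri i j u → u = R ∨ u = Y →
      comp i j = some u := by decide
  constructor
  · rintro ⟨i, h1, h2, h3⟩
    by_cases hi : i = 0
    · subst hi
      rw [e0] at h1 h3
      exact Or.inr ⟨h3, fun b hb => (kG _ _ (hne b hb).1 (hne b hb).2).1 (h1 b hb)⟩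
    · have h0 := h2 0 (Fin.pos_iff_ne_zero.2 hi)
      rw [e0] at h0
      push Not at h0
      obtain ⟨b, hb, h0⟩ := h0
      refine Or.inl ⟨b, hb, kRY _ _ (hne b hb).1 (hne b hb).2 _ h0 (d_tri a b c) ?_⟩
      rw [h3]
      revert hi
      fin_cases i <;> decide
  · rintro (⟨b, hb, h⟩ | ⟨h, hn⟩)
    · have hs := solution_of_comp h (hne b hb).1 (hne b hb).2
      have k : ∀ i j : Hue, i ≠ E → j ≠ E → ∀ u, comp i j = some u →
          ¬ tri i j Hue.G ∧ (u ≠ R → ¬ tri i j R) ∧ u ≠ Hue.G := by decide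
      obtain ⟨k1, k2, k3⟩ := k _ _ (hne b hb).1 (hne b hb).2 _ h
      rcases hs with hs | hs | hs
      · refine ⟨1, fun b' _ => ?_, fun j hj h' => ?_, hs⟩
        · rw [e1, ← hs]; exact d_tri a b' c
        · have : j = 0 := by omega
          subst this
          exact k1 (h' b hb)
      · exact absurd hs k3
      · refine ⟨2, fun b' _ => ?_, fun j hj h' => ?_, hs⟩
        · rw [e2, ← hs]; exact d_tri a b' c
        · have : j = 0 ∨ j = 1 := by omega
          rcases this with rfl | rfl
          · exact k1 (h' b hb)
          · exact k2 (by rw [hs]; decide) (h' b hb)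
    · exact ⟨0, fun b hb => (kG _ _ (hne b hb).1 (hne b hb).2).2 (hn b hb),
        fun j hj => absurd hj (Fin.not_lt_zero j), h⟩

theorem isPrioritisedAmalgam_iff {A B C : Set M} (hA : B ⊆ A) (hC : B ⊆ C) :
    IsPrioritisedAmalgam S26 order26 A B C ↔ Perp A B C := by
  constructor
  · rintro ⟨-, -, -, h⟩ a ha c hc
    by_cases haB : a ∈ B
    · exact ind_of_mem_left haB
    by_cases hcB : c ∈ B
    · exact ind_of_mem_right hcB
    exact (exists_priority_iff haB hcB).1 (h a ⟨ha, haB⟩ c ⟨hc, hcB⟩)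
  · intro h
    refine ⟨hA, hC, subset_antisymm (fun x hx => mem_of_ind_self (h x hx.1 x hx.2))
      (Set.subset_inter hA hC), fun a ha c hc => ?_⟩
    exact (exists_priority_iff ha.2 hc.2).2 (h a ha.1 c hc.1)

theorem indep_iff {A B C : Set M} : Indep S26 order26 A B C ↔ Perp A B C := by
  rw [Indep, isPrioritisedAmalgam_iff Set.subset_union_right Set.subset_union_left]
  constructor
  · exact fun h => h.subset Set.subset_union_left Set.subset_union_right
  · exact fun h => (((perp_of_subset_right subset_rfl).union_right h)).union_left
      (perp_of_subset_left subset_rfl)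

end Dictionary

/-! ### The colour function of a complete structure -/

open Classical in
/-- The colour function of a complete structure without forbidden triangles. -/
noncomputable abbrev colourSpaceOf {M : Type w} [L26.Structure M] (hc : IsComplete Colour M)
    (ho : OmitsTriangles S26 M) : ColourSpace M where
  d a b := if h : a = b then E else hue (hc.exactly_one a b h).choose
  triOn := by
    have h0 : ∀ a b : M, (if h : a = b then E else hue (hc.exactly_one a b h).choose) = E ↔
        a = b := by
      intro a b
      split_ifs with h
      · simp [h]
      · simp [h, hue_ne_eq]
    have h1 : ∀ (a b : M) (i : Colour), HasColour i a b →
        (if h : a = b then E else hue (hc.exactly_one a b h).choose) = hue i := by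
      intro a b i hi
      have hab : a ≠ b := by rintro rfl; exact hc.irrefl i a hi
      rw [dif_neg hab]
      exact congrArg hue (((hc.exactly_one a b hab).choose_spec.2 i hi)).symm
    have h2 : ∀ a b : M, a ≠ b → ∃ i : Colour, HasColour i a b := fun a b hab =>
      (hc.exactly_one a b hab).exists
    refine ⟨fun a _ b _ => h0 a b, fun a _ b _ => ?_, fun a _ b _ c _ => ?_⟩
    · by_cases hab : a = b
      · subst hab; rfl
      · obtain ⟨i, hi⟩ := h2 a b hab
        rw [h1 a b i hi, h1 b a i (hc.symm i a b hi)]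
    · by_cases hab : a = b
      · subst hab
        rw [(h0 a a).2 rfl, tri_rfl_left]
      by_cases hbc : b = c
      · subst hbc
        rw [(h0 b b).2 rfl]; exact tri_eq_mid _
      obtain ⟨i, hi⟩ := h2 a b hab
      obtain ⟨j, hj⟩ := h2 b c hbc
      by_cases hac : a = c
      · subst hac
        rw [h1 a b i hi, h1 b a i (hc.symm i a b hi), (h0 a a).2 rfl]
        have key : ∀ i : Colour, tri (hue i) (hue i) E := by decide
        exact key i
      obtain ⟨k, hk⟩ := h2 a c hac
      rw [h1 a b i hi, h1 b c j hj, h1 a c k hk, tri_hue_iff]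
      exact ho a b c hab hbc hac i j k hi hj hk

theorem isColouring_colourSpaceOf {M : Type w} [L26.Structure M] (hc : IsComplete Colour M)
    (ho : OmitsTriangles S26 M) : @IsColouring M _ (colourSpaceOf hc ho) := by
  classical
  let _ := colourSpaceOf hc ho
  refine ⟨fun i a b => ?_⟩
  have hd : d a b = if h : a = b then E else hue (hc.exactly_one a b h).choose := rfl
  by_cases hab : a = b
  · subst hab
    rw [hd, dif_pos rfl]
    exact ⟨fun h => absurd h (hc.irrefl i a), fun h => absurd h.symm (hue_ne_eq i)⟩
  · rw [hd, dif_neg hab]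
    refine ⟨fun h => congrArg hue ((hc.exactly_one a b hab).choose_spec.2 i h).symm, fun h => ?_⟩
    rw [← hue_injective h]
    exact (hc.exactly_one a b hab).choose_spec.1

/-- The colour function pulled back along an injective map. -/
abbrev ColourSpace.comap {M N : Type*} [ColourSpace N] (f : M → N) (hf : Function.Injective f) :
    ColourSpace M where
  d a b := d (f a) (f b)
  triOn := ⟨fun _ _ _ _ => d_eq_iff.trans hf.eq_iff, fun _ _ _ _ => d_comm _ _,
    fun _ _ _ _ _ _ => d_tri _ _ _⟩

theorem hasColour_map {M N : Type*} [L26.Structure M] [L26.Structure N] (f : M ↪[L26] N)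
    (i : Colour) (a b : M) : HasColour i (f a) (f b) ↔ HasColour i a b := by
  have h := f.map_rel (ColourRel.rel i : L26.Relations 2) ![a, b]
  have e : f ∘ ![a, b] = ![f a, f b] := by funext k; fin_cases k <;> rfl
  rwa [e] at h

theorem isColouring_comap {M N : Type*} [L26.Structure M] [L26.Structure N] [ColourSpace N]
    [IsColouring N] (f : M ↪[L26] N) :
    @IsColouring M _ (ColourSpace.comap f f.injective) :=
  letI := ColourSpace.comap f f.injective
  ⟨fun i a b => (hasColour_map f i a b).symm.trans (IsColouring.hasColour_iff i (f a) (f b))⟩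

/-- A map that preserves the colour functions is an embedding. -/
def embeddingOfColour {M N : Type*} [L26.Structure M] [L26.Structure N] [ColourSpace M]
    [ColourSpace N] [IsColouring M] [IsColouring N] (f : M → N)
    (hf : ∀ a b, d (f a) (f b) = d a b) : M ↪[L26] N where
  toFun := f
  inj' a b h := d_eq_iff.1 (by rw [← hf, h, d_self])
  map_fun' r := by cases r
  map_rel' r x := by
    cases r with
    | rel i =>
      have h1 := IsColouring.hasColour_iff i (x 0) (x 1)
      have h2 := IsColouring.hasColour_iff i (f (x 0)) (f (x 1))
      rw [hf, ← h1] at h2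
      unfold HasColour at h2
      have e1 : f ∘ x = ![f (x 0), f (x 1)] := by funext k; fin_cases k <;> rfl
      have e2 : x = ![x 0, x 1] := by funext k; fin_cases k <;> rfl
      rw [e1]
      conv_rhs => rw [e2]
      exact h2

/-! ### The generic countable structure -/

/-- A one-point type over a subset of `S` is realised in an extension of `S` by one point. -/
theorem exists_triOn_insert {M : Type w} {d : M → M → Hue} {S B : Set M} {p : M → Hue}
    (hd : TriOn d S) (hB : B ⊆ S) (hp : ∀ b ∈ B, p b ≠ E)
    (ht : ∀ b ∈ B, ∀ b' ∈ B, tri (p b) (d b b') (p b')) {x : M} (hx : x ∉ S) :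
    ∃ d' : M → M → Hue, TriOn d' (insert x S) ∧ (∀ a ∈ S, ∀ b ∈ S, d' a b = d a b) ∧
      ∀ b ∈ B, d' x b = p b := by
  classical
  have hr := freeValue_tri hd hB hp ht
  have hr' := freeValue_ne_eq d hp
  have hne : ∀ a ∈ S, a ≠ x := fun a ha h => hx (h ▸ ha)
  obtain ⟨d', hd'⟩ : ∃ d' : M → M → Hue, d' = fun a b => if a = x then
      (if b = x then E else freeValue d B p b) else if b = x then freeValue d B p a else d a b :=
    ⟨_, rfl⟩
  have e0 : d' x x = E := by simp [hd']
  have e1 : ∀ a ∈ S, d' x a = freeValue d B p a := fun a ha => by simp [hd', hne a ha]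
  have e2 : ∀ a ∈ S, d' a x = freeValue d B p a := fun a ha => by simp [hd', hne a ha]
  have e3 : ∀ a ∈ S, ∀ b ∈ S, d' a b = d a b := fun a ha b hb => by
    simp [hd', hne a ha, hne b hb]
  refine ⟨d', ⟨?_, ?_, ?_⟩, e3, fun b hb => ?_⟩
  · rintro a (rfl | ha) b (rfl | hb)
    · simp [e0]
    · simp [e1 b hb, hr' b, (hne b hb).symm]
    · simp [e2 a ha, hr' a, hne a ha]
    · rw [e3 a ha b hb, hd.eq_iff a ha b hb]
  · rintro a (rfl | ha) b (rfl | hb)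
    · rfl
    · rw [e1 b hb, e2 b hb]
    · rw [e1 a ha, e2 a ha]
    · rw [e3 a ha b hb, e3 b hb a ha, hd.symm a ha b hb]
  · rintro a (rfl | ha) b (rfl | hb) c (rfl | hc)
    · rw [e0]; rfl
    · rw [e0, tri_rfl_left]
    · rw [e0, e1 b hb, e2 b hb]; exact tri_self_self _
    · rw [e1 b hb, e1 c hc, e3 b hb c hc]; exact hr b hb c hc
    · rw [e0]; exact tri_eq_mid _
    · rw [e1 c hc, e2 a ha, e3 a ha c hc]; exact tri_swap_right (hr a ha c hc)
    · rw [e2 a ha, e2 b hb, e3 a ha b hb]; exact tri_turn (hr a ha b hb)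
    · rw [e3 a ha b hb, e3 b hb c hc, e3 a ha c hc]; exact hd.tri a ha b hb c hc
  · rw [e1 b (hB hb)]; simp [freeValue, hb]

/-- Points are added one at a time. Every finite one-point type is listed infinitely often, through
the second factor of `T × ℕ`, so it comes up after all its parameters exist and is then realised if
consistent. -/
theorem exists_universal : ∃ d : ℕ → ℕ → Hue, TriOn d Set.univ ∧
    ∀ (B : Finset ℕ) (p : ℕ → Hue), (∀ b ∈ B, p b ≠ E) →
      (∀ b ∈ B, ∀ b' ∈ B, tri (p b) (d b b') (p b')) → ∃ m, ∀ b ∈ B, d m b = p b := by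
  classical
  let T := Σ B : Finset ℕ, (B → Hue)
  have : Nonempty T := ⟨⟨∅, fun _ => E⟩⟩
  let q : T → ℕ → Hue := fun τ b => if h : b ∈ τ.1 then τ.2 ⟨b, h⟩ else E
  obtain ⟨t, ht⟩ := exists_surjective_nat (T × ℕ)
  let Valid : (ℕ → ℕ → Hue) → T → Prop := fun e τ => (∀ b ∈ τ.1, q τ b ≠ E) ∧
    ∀ b ∈ τ.1, ∀ b' ∈ τ.1, tri (q τ b) (e b b') (q τ b')
  obtain ⟨s, hs⟩ := exists_seq_of_step (σ := ℕ × (ℕ → ℕ → Hue))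
    (fun s => TriOn s.2 (Set.Iio s.1)) (0, fun _ _ => E)
    ⟨fun a ha => absurd ha (Nat.not_lt_zero a), fun a ha => absurd ha (Nat.not_lt_zero a),
      fun a ha => absurd ha (Nat.not_lt_zero a)⟩
    (fun n s s' => s'.1 = s.1 + 1 ∧ (∀ a < s.1, ∀ b < s.1, s'.2 a b = s.2 a b) ∧
      ((∀ b ∈ (t n).1.1, b < s.1) → Valid s.2 (t n).1 →
        ∀ b ∈ (t n).1.1, s'.2 s.1 b = q (t n).1 b))
    (by
      rintro n ⟨k, e⟩ he
      have hk : insert k (Set.Iio k) = Set.Iio (k + 1) := by ext x; simp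
      by_cases h : (∀ b ∈ (t n).1.1, b < k) ∧ Valid e (t n).1
      · obtain ⟨d', h1, h2, h3⟩ := exists_triOn_insert he (B := (t n).1.1) (p := q (t n).1)
          (fun b hb => h.1 b hb) h.2.1 h.2.2 (x := k) (lt_irrefl k)
        exact ⟨(k + 1, d'), hk ▸ h1, rfl, h2, fun _ _ => h3⟩
      · obtain ⟨d', h1, h2, -⟩ := exists_triOn_insert he (B := ∅) (p := q (t n).1)
          (Set.empty_subset _) (by simp) (by simp) (x := k) (lt_irrefl k)
        exact ⟨(k + 1, d'), hk ▸ h1, rfl, h2, fun h4 h5 => absurd ⟨h4, h5⟩ h⟩)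
  -- Only the recurrence is known about the sequence, not its initial term, so `k` stays
  -- unspecified.
  have h0 : ∃ k, ∀ n, (s n).1 = k + n := by
    refine ⟨(s 0).1, fun n => ?_⟩
    induction n with
    | zero => rfl
    | succ n ih => rw [(hs n).2.1, ih, add_assoc]
  obtain ⟨k, hk⟩ := h0
  have stable : ∀ n m, n ≤ m → ∀ a < k + n, ∀ b < k + n, (s m).2 a b = (s n).2 a b := by
    intro n m hnm a ha b hb
    induction m, hnm using Nat.le_induction with
    | base => rfl
    | succ m hm ih =>
      rw [← ih]
      exact (hs m).2.2.1 a (by rw [hk]; omega) b (by rw [hk]; omega)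
  let D : ℕ → ℕ → Hue := fun a b => (s (max a b + 1)).2 a b
  have hD : ∀ n a b, a < n → b < n → D a b = (s n).2 a b := fun n a b ha hb =>
    (stable _ n (by omega) a (by omega) b (by omega)).symm
  have hS : ∀ n, TriOn (s n).2 (Set.Iio (k + n)) := fun n => by rw [← hk]; exact (hs n).1
  have hm : ∀ a n, a < n → a ∈ Set.Iio (k + n) := fun a n h => by simp; omega
  refine ⟨D, ⟨fun a _ b _ => ?_, fun a _ b _ => ?_, fun a _ b _ c _ => ?_⟩,
    fun B p hp hpt => ?_⟩
  · obtain ⟨n, h1, h2⟩ : ∃ n, a < n ∧ b < n := ⟨max a b + 1, by omega, by omega⟩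
    rw [hD n a b h1 h2]
    exact (hS n).eq_iff a (hm a n h1) b (hm b n h2)
  · obtain ⟨n, h1, h2⟩ : ∃ n, a < n ∧ b < n := ⟨max a b + 1, by omega, by omega⟩
    rw [hD n a b h1 h2, hD n b a h2 h1]
    exact (hS n).symm a (hm a n h1) b (hm b n h2)
  · obtain ⟨n, h1, h2, h3⟩ : ∃ n, a < n ∧ b < n ∧ c < n :=
      ⟨max a (max b c) + 1, by omega, by omega, by omega⟩
    rw [hD n a b h1 h2, hD n b c h2 h3, hD n a c h1 h3]
    exact (hS n).tri a (hm a n h1) b (hm b n h2) c (hm c n h3)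
  · let τ : T := ⟨B, fun b => p b⟩
    have hq : ∀ b ∈ B, q τ b = p b := fun b hb => dif_pos hb
    obtain ⟨n, hn, hBn⟩ : ∃ n, (t n).1 = τ ∧ ∀ b ∈ B, b < n := by
      -- The tasks `(τ, j)` occur at distinct times for distinct `j`, so some time exceeds every
      -- element of `B`.
      by_contra! hcon
      choose f hf using fun j => ht (τ, j)
      have hinj : Function.Injective f := fun i j hij => by
        have := (hf i).symm.trans ((congrArg t hij).trans (hf j))
        exact (Prod.mk.inj this).2
      obtain ⟨j, hj⟩ := (Set.infinite_range_of_injective hinj).exists_gt (B.sup id)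
      obtain ⟨⟨i, rfl⟩, hlt⟩ := hj
      obtain ⟨b, hb, hb'⟩ := hcon (f i) (by rw [hf])
      exact absurd (Finset.le_sup (f := id) hb) (by simp only [id]; omega)
    refine ⟨(s n).1, fun b hb => ?_⟩
    have hlt : ∀ b ∈ B, b < (s n).1 := fun b hb => by rw [hk]; have := hBn b hb; omega
    have h3 := (hs n).2.2.2
    rw [hn] at h3
    have h4 := h3 hlt ⟨fun b hb => by rw [hq b hb]; exact hp b hb, fun b hb b' hb' => by
      rw [hq b hb, hq b' hb', ← hD n b b' (hBn b hb) (hBn b' hb')]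
      exact hpt b hb b' hb'⟩ b hb
    rw [← hq b hb, ← h4]
    rw [show D (s n).1 b = (s ((s n).1 + 2)).2 (s n).1 b from
      hD _ _ _ (by omega) (by have := hlt b hb; omega)]
    refine stable (n + 1) _ (by rw [hk]; omega) _ (by rw [hk]; omega) _ ?_
    have := hBn b hb
    omega

/-! ### The Fraïssé limit -/

/-- Every one-point type over a finite set is realised. -/
def RealisesTypes (M : Type w) [ColourSpace M] : Prop :=
  ∀ A : Set M, A.Finite → ∀ p : M → Hue, (∀ a ∈ A, p a ≠ E) →
    (∀ a ∈ A, ∀ b ∈ A, tri (p a) (d a b) (p b)) → ∃ m : M, ∀ a ∈ A, d m a = p a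

/-- The structure with a given colour function. -/
abbrev structureOf (M : Type w) [ColourSpace M] : L26.Structure M where
  funMap f := f.elim
  RelMap {_} r := match r with
    | ColourRel.rel i => fun v => d (v 0) (v 1) = Colour.hue i

theorem isColouring_structureOf (M : Type w) [ColourSpace M] :
    @IsColouring M (structureOf M) _ :=
  letI := structureOf M
  ⟨fun _ _ _ => Iff.rfl⟩

theorem exists_countable_realisesTypes : ∃ (U : Type w) (_ : L26.Structure U)
    (_ : ColourSpace U), Countable U ∧ IsColouring U ∧ RealisesTypes U := by
  obtain ⟨D, hD, hp⟩ := exists_universal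
  let i₀ : ColourSpace ℕ := ⟨D, hD⟩
  let i₁ : ColourSpace (ULift.{w} ℕ) := ColourSpace.comap ULift.down ULift.down_injective
  refine ⟨ULift.{w} ℕ, structureOf _, i₁, inferInstance, isColouring_structureOf _, ?_⟩
  intro A hA p hpE hpt
  obtain ⟨m, hm⟩ := hp (hA.image ULift.down).toFinset (fun n => p ⟨n⟩)
    (by
      intro b hb
      obtain ⟨a, ha, rfl⟩ := (Set.Finite.mem_toFinset _).1 hb
      exact hpE a ha)
    (by
      intro b hb b' hb'
      obtain ⟨a, ha, rfl⟩ := (Set.Finite.mem_toFinset _).1 hb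
      obtain ⟨a', ha', rfl⟩ := (Set.Finite.mem_toFinset _).1 hb'
      exact hpt a ha a' ha')
  exact ⟨⟨m⟩, fun a ha => hm a.down ((Set.Finite.mem_toFinset _).2 ⟨a, ha, rfl⟩)⟩

section Realise

variable {M : Type w} [ColourSpace M]

theorem RealisesTypes.exists_extend (hM : RealisesTypes M) {K : Type*} [ColourSpace K] {S : Set K}
    (hS : S.Finite) (f : K → M) (hf : ∀ a ∈ S, ∀ b ∈ S, d (f a) (f b) = d a b) (x : K) :
    ∃ f' : K → M, (∀ a ∈ S, f' a = f a) ∧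
      ∀ a ∈ insert x S, ∀ b ∈ insert x S, d (f' a) (f' b) = d a b := by
  classical
  by_cases hx : x ∈ S
  · exact ⟨f, fun _ _ => rfl, by rwa [Set.insert_eq_of_mem hx]⟩
  have : Nonempty K := ⟨x⟩
  have hinj : Set.InjOn f S := fun a ha b hb h => d_eq_iff.1 (by rw [← hf a ha b hb, h, d_self])
  have hg : ∀ a ∈ S, Function.invFunOn f S (f a) = a := hinj.leftInvOn_invFunOn
  have hne : ∀ a ∈ S, a ≠ x := fun a ha h => hx (h ▸ ha)
  obtain ⟨m, hm⟩ := hM (f '' S) (hS.image f) (fun y => d x (Function.invFunOn f S y))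
    (by
      rintro _ ⟨a, ha, rfl⟩ h
      rw [hg a ha, d_eq_iff] at h
      exact hne a ha h.symm)
    (by
      rintro _ ⟨a, ha, rfl⟩ _ ⟨b, hb, rfl⟩
      rw [hg a ha, hg b hb, hf a ha b hb]
      exact d_tri x a b)
  have hm' : ∀ a ∈ S, d m (f a) = d x a := fun a ha => by
    rw [hm _ ⟨a, ha, rfl⟩, hg a ha]
  refine ⟨Function.update f x m, fun a ha => Function.update_of_ne (hne a ha) _ _, ?_⟩
  rintro a (rfl | ha) b (rfl | hb)
  · simp [d_self]
  · rw [Function.update_self, Function.update_of_ne (hne b hb), hm' b hb]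
  · rw [Function.update_self, Function.update_of_ne (hne a ha), d_comm, hm' a ha, d_comm]
  · rw [Function.update_of_ne (hne b hb), Function.update_of_ne (hne a ha), hf a ha b hb]

theorem RealisesTypes.exists_map (hM : RealisesTypes M) (K : Type*) [ColourSpace K] [Finite K] :
    ∃ f : K → M, ∀ a b, d (f a) (f b) = d a b := by
  have key : ∀ S : Set K, S.Finite → ∃ f : K → M, ∀ a ∈ S, ∀ b ∈ S, d (f a) (f b) = d a b := by
    intro S hS
    induction S, hS using Set.Finite.induction_on with
    | empty =>
      obtain ⟨m, -⟩ := hM ∅ Set.finite_empty (fun _ => Hue.G) (by simp) (by simp)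
      exact ⟨fun _ => m, by simp⟩
    | @insert x S _ hS ih =>
      obtain ⟨f, hf⟩ := ih
      obtain ⟨f', -, hf'⟩ := hM.exists_extend hS f hf x
      exact ⟨f', hf'⟩
  obtain ⟨f, hf⟩ := key Set.univ Set.finite_univ
  exact ⟨f, fun a b => hf a trivial b trivial⟩

variable [L26.Structure M] [IsColouring M]

theorem mem_forb_of_embedding {A : Bundled.{w} L26.Structure} [Finite A] (f : A ↪[L26] M) :
    A ∈ Forb S26 := by
  let _ := ColourSpace.comap f f.injective
  have := isColouring_comap f
  exact ⟨inferInstance, isComplete_of_colouring, omitsTriangles_of_colouring⟩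

theorem RealisesTypes.age_eq (hM : RealisesTypes M) : L26.age M = Forb S26 := by
  ext A
  constructor
  · rintro ⟨hA, ⟨f⟩⟩
    have := Structure.fg_iff_finite.1 hA
    exact mem_forb_of_embedding f
  · rintro ⟨hA, hc, ho⟩
    let _ := colourSpaceOf hc ho
    have := isColouring_colourSpaceOf hc ho
    obtain ⟨f, hf⟩ := hM.exists_map A
    exact ⟨Structure.fg_iff_finite.2 hA, ⟨embeddingOfColour f hf⟩⟩

/-- Realising one-point types extends a finite partial embedding by one point, and countability
turns this extension property into homogeneity. -/
theorem RealisesTypes.isUltrahomogeneous [Countable M] (hM : RealisesTypes M) :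
    L26.IsUltrahomogeneous M := by
  classical
  refine (isUltrahomogeneous_iff_IsExtensionPair Structure.cg_of_countable).2
    (isExtensionPair_iff_exists_embedding_closure_singleton_sup.2 fun S hS f m => ?_)
  have hfin : (S : Set M).Finite := hS.finite
  have hd : ∀ x y : S, d (f x) (f y) = d (x : M) (y : M) := by
    intro x y
    refine d_eq_d_iff.2 ⟨by rw [f.injective.eq_iff, Subtype.ext_iff], fun i => ?_⟩
    rw [hasColour_map f]
    exact (hasColour_map S.subtype i x y).symm
  obtain ⟨f', h1, h2⟩ := hM.exists_extend hfin
    (fun x => if h : x ∈ S then f ⟨x, h⟩ else x)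
    (by
      intro a ha b hb
      rw [dif_pos (SetLike.mem_coe.1 ha), dif_pos (SetLike.mem_coe.1 hb)]
      exact hd _ _) m
  let T : L26.Substructure M := Substructure.closure L26 {m} ⊔ S
  have hT : ∀ x ∈ T, x ∈ insert m (S : Set M) := by
    intro x hx
    have e : T = Substructure.closure L26 ({m} ∪ (S : Set M)) := by
      rw [Substructure.closure_union, Substructure.closure_eq]
    rw [e, Substructure.mem_closure_iff_of_isRelational] at hx
    exact hx
  let _ : ColourSpace T := ColourSpace.comap T.subtype T.subtype.injective
  have : IsColouring T := isColouring_comap T.subtype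
  refine ⟨embeddingOfColour (M := T) (fun x => f' x)
    (fun a b => h2 a (hT a a.2) b (hT b b.2)), ?_⟩
  ext x
  refine Eq.trans ?_ (h1 x x.2).symm
  rw [dif_pos x.2]

theorem RealisesTypes.isFraisseLimit [Countable M] (hM : RealisesTypes M) :
    IsFraisseLimit (Forb.{w} S26) M :=
  ⟨hM.isUltrahomogeneous, hM.age_eq⟩

end Realise

theorem RealisesTypes.of_equiv {M N : Type w} [L26.Structure M] [L26.Structure N] [ColourSpace N]
    (hN : RealisesTypes N) (φ : M ≃[L26] N) :
    @RealisesTypes M (ColourSpace.comap φ φ.injective) := by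
  intro A hA p hp hpt
  obtain ⟨m, hm⟩ := hN (φ '' A) (hA.image φ) (fun y => p (φ.symm y))
    (by rintro _ ⟨a, ha, rfl⟩; simpa using hp a ha)
    (by
      rintro _ ⟨a, ha, rfl⟩ _ ⟨b, hb, rfl⟩
      simp only [FirstOrder.Language.Equiv.symm_apply_apply]
      exact hpt a ha b hb)
  refine ⟨φ.symm m, fun a ha => ?_⟩
  change d (φ (φ.symm m)) (φ a) = p a
  rw [FirstOrder.Language.Equiv.apply_symm_apply, hm _ ⟨a, ha, rfl⟩,
    FirstOrder.Language.Equiv.symm_apply_apply]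

/-- The colour function of a Fraïssé limit. -/
theorem exists_realisesTypes {M : Type w} [L26.Structure M] [Countable M]
    (h : IsFraisseLimit (Forb.{w} S26) M) :
    ∃ _ : ColourSpace M, IsColouring M ∧ RealisesTypes M := by
  obtain ⟨U, i₁, i₂, i₃, i₄, hU⟩ := exists_countable_realisesTypes.{w}
  -- Uniqueness of the limit reduces to the structure built by hand.
  obtain ⟨φ⟩ := h.nonempty_equiv hU.isFraisseLimit
  exact ⟨ColourSpace.comap φ φ.injective, isColouring_comap φ.toEmbedding, hU.of_equiv φ⟩

/-! ### The automorphism group of the Fraïssé limit -/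

instance autMulAction (M : Type w) [L26.Structure M] : MulAction (M ≃[L26] M) M where
  smul g x := g x
  one_smul _ := rfl
  mul_smul _ _ _ := rfl

theorem aut_smul_set {M : Type w} [L26.Structure M] (g : M ≃[L26] M) (A : Set M) :
    g '' A = g • A := rfl

theorem colourHomogeneous_aut {M : Type w} [L26.Structure M] [ColourSpace M] [IsColouring M]
    (hu : L26.IsUltrahomogeneous M) (hM : RealisesTypes M) :
    ColourHomogeneous (M ≃[L26] M) M where
  d_smul g a b := d_eq_d_iff.2 ⟨g.injective.eq_iff, fun i => hasColour_map g.toEmbedding i a b⟩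
  extend_map A hA f hf := by
    let T : L26.Substructure M := Substructure.closure L26 A
    have hT : ∀ x ∈ T, x ∈ A := fun x hx => by
      rwa [Substructure.mem_closure_iff_of_isRelational] at hx
    let _ : ColourSpace T := ColourSpace.comap T.subtype T.subtype.injective
    have : IsColouring T := isColouring_comap T.subtype
    obtain ⟨g, hg⟩ := hu T (Substructure.fg_closure hA) (embeddingOfColour (M := T) (fun x => f x)
      (fun a b => hf a (hT a a.2) b (hT b b.2)))
    refine ⟨g, fun a ha => ?_⟩
    have := DFunLike.congr_fun hg ⟨a, Substructure.subset_closure ha⟩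
    exact this.symm
  one_point := hM
  full e he := ⟨{ e with
    map_fun' := fun r => by cases r
    map_rel' := (embeddingOfColour e he).map_rel' }, fun _ => rfl⟩
  faithful _ _ h := FirstOrder.Language.Equiv.ext h

/-! ### Prioritised amalgamation and the independence relation -/

theorem ind_comap {M N : Type*} [ColourSpace N] {f : M → N} (hf : Function.Injective f)
    {B : Set M} {a c : M} (h : ind (f '' B) (f a) (f c)) :
    @ind M (ColourSpace.comap f hf) B a c := by
  rcases h with ⟨_, ⟨b, hb, rfl⟩, h⟩ | ⟨h, hn⟩
  · exact Or.inl ⟨b, hb, h⟩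
  · exact Or.inr ⟨h, fun b hb => hn _ ⟨b, hb, rfl⟩⟩

/-- The amalgam is found inside the limit: homogeneity embeds `A` and `C` so that they agree on `B`,
the copy of `A` is made independent from that of `C` over `B`, and the union is taken. -/
theorem exists_prioritisedAmalgam {A B C : Bundled.{w} L26.Structure} (hA : A ∈ Forb S26)
    (hB : B ∈ Forb S26) (hC : C ∈ Forb S26) (f₁ : B ↪[L26] A) (f₂ : B ↪[L26] C) :
    ∃ D ∈ Forb.{w} S26, ∃ (g₁ : A ↪[L26] D) (g₂ : C ↪[L26] D),
      (∀ b, g₁ (f₁ b) = g₂ (f₂ b)) ∧ Set.range g₁ ∪ Set.range g₂ = Set.univ ∧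
      IsPrioritisedAmalgam S26 order26 (Set.range g₁) (Set.range fun b => g₁ (f₁ b))
        (Set.range g₂) := by
  obtain ⟨U, _, _, _, _, hU⟩ := exists_countable_realisesTypes.{w}
  have := colourHomogeneous_aut hU.isUltrahomogeneous hU
  have := hA.1
  have := hB.1
  have := hC.1
  rw [← hU.age_eq] at hA hB hC
  obtain ⟨α⟩ := hA.2
  have := hC.2
  obtain ⟨γ, hγ⟩ := hU.isUltrahomogeneous.extend_embedding hB.1 (α.comp f₁) f₂
  have hγ' : ∀ b, α (f₁ b) = γ (f₂ b) := DFunLike.congr_fun hγ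
  obtain ⟨s, hs, hp⟩ := exists_perp (U ≃[L26] U) (Set.finite_range α)
    (Set.finite_range fun b => α (f₁ b)) (Set.finite_range γ)
  let T : L26.Substructure U := Substructure.closure L26 (s • Set.range α ∪ Set.range γ)
  have hT : ∀ x ∈ T, x ∈ s • Set.range α ∪ Set.range γ := fun x hx => by
    rwa [Substructure.mem_closure_iff_of_isRelational] at hx
  have hTf : Finite T :=
    (((Set.finite_range α).smul_set.union (Set.finite_range γ)).subset hT).to_subtype
  let _ : ColourSpace T := ColourSpace.comap T.subtype T.subtype.injective
  have : IsColouring T := isColouring_comap T.subtype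
  let g₁ : A ↪[L26] T := (s.toEmbedding.comp α).codRestrict T fun x =>
    Substructure.subset_closure (Or.inl (Set.smul_mem_smul_set ⟨x, rfl⟩))
  let g₂ : C ↪[L26] T := γ.codRestrict T fun x => Substructure.subset_closure (Or.inr ⟨x, rfl⟩)
  have hg : ∀ b, g₁ (f₁ b) = g₂ (f₂ b) := fun b =>
    Subtype.ext ((hs _ ⟨b, rfl⟩).trans (hγ' b))
  refine ⟨⟨T, inferInstance⟩, mem_forb_of_embedding (A := ⟨T, inferInstance⟩) T.subtype, g₁, g₂,
    hg, ?_, ?_⟩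
  · refine Set.eq_univ_of_forall fun x => ?_
    rcases hT x x.2 with ⟨_, ⟨a, rfl⟩, h⟩ | ⟨c, h⟩
    · exact Or.inl ⟨a, Subtype.ext h⟩
    · exact Or.inr ⟨c, Subtype.ext h⟩
  · refine (isPrioritisedAmalgam_iff (M := T) ?_ ?_).2 ?_
    · rintro _ ⟨b, rfl⟩
      exact ⟨f₁ b, rfl⟩
    · rintro _ ⟨b, rfl⟩
      exact ⟨f₂ b, (hg b).symm⟩
    · rintro _ ⟨a, rfl⟩ _ ⟨c, rfl⟩
      refine ind_comap T.subtype.injective ?_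
      have e : T.subtype '' (Set.range fun b => g₁ (f₁ b)) = Set.range fun b => α (f₁ b) := by
        rw [← Set.range_comp]
        exact congrArg Set.range (funext fun b => hs _ ⟨b, rfl⟩)
      rw [e]
      exact hp _ (Set.smul_mem_smul_set ⟨a, rfl⟩) _ ⟨c, rfl⟩

theorem order26_injective : Function.Injective order26 := by
  unfold order26
  decide

theorem isPrioritisedSemiFree : IsPrioritisedSemiFree.{w} S26 order26 where
  injective := order26_injective
  proper := Set.ssubset_univ_iff.2 fun h => by
    have : ∀ i, order26 i ≠ Colour.X := by unfold order26; decide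
    obtain ⟨i, hi⟩ := (h ▸ Set.mem_univ Colour.X : Colour.X ∈ Set.range order26)
    exact this i hi
  isFraisse := by
    obtain ⟨U, _, _, _, _, hU⟩ := exists_countable_realisesTypes.{w}
    exact hU.isFraisseLimit.isFraisse
  amalgam_mem _ _ _ hA hB hC f₁ f₂ := exists_prioritisedAmalgam hA hB hC f₁ f₂

section Limit

variable {M : Type w} [L26.Structure M] [ColourSpace M] [IsColouring M]

theorem isStationaryIndependence [ColourHomogeneous (M ≃[L26] M) M] :
    IsStationaryIndependence L26 (M := M) (Indep S26 order26) where
  invariance g A B C _ _ _ h := indep_iff.2 ((indep_iff.1 h).smul g)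
  monotonicity A B C D _ _ _ _ h := by
    have h := indep_iff.1 h
    refine ⟨indep_iff.2 (h.right Set.subset_union_left), indep_iff.2 ?_⟩
    exact (h.right Set.subset_union_right).mono_base Set.subset_union_left
      ((perp_of_subset_right subset_rfl).union_right (h.right Set.subset_union_left))
  transitivity A B C D _ _ _ _ h h' := indep_iff.2
    (Perp.trans ((perp_of_subset_right subset_rfl).union_right (indep_iff.1 h))
      Set.subset_union_left (indep_iff.1 h'))
  symmetry A B C _ _ _ h := indep_iff.2 (indep_iff.1 h).symm
  existence n p B C hB hC := by
    obtain ⟨g, hg, hp⟩ := exists_perp (M ≃[L26] M) (Set.finite_range p) hB hC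
    refine ⟨fun i => g (p i), ⟨g, hg, fun _ => rfl⟩, indep_iff.2 (hp.left ?_)⟩
    rintro _ ⟨i, rfl⟩
    exact Set.smul_mem_smul_set ⟨i, rfl⟩
  stationarity n a a' B C hB hC := by
    rintro ⟨σ, hσ, ha⟩ h h'
    have e : σ • Set.range a = Set.range a' := by
      rw [← aut_smul_set, ← Set.range_comp]
      exact congrArg Set.range (funext ha)
    have hB' : σ • B = B := Fixes.smul_set hσ
    obtain ⟨k, hk, hk'⟩ := exists_glue (g := σ) (h := 1) (A := Set.range a) (B := B)
      (C := B ∪ C) (Set.finite_range a) (hB.union hC)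
      (fun b hb => (hσ b hb).trans (one_smul _ b).symm)
      ((perp_of_subset_right subset_rfl).union_right (indep_iff.1 h))
      (by
        rw [e, hB', one_smul]
        exact (perp_of_subset_right subset_rfl).union_right (indep_iff.1 h'))
    exact ⟨k, fun b hb => (hk' b hb).trans (one_smul _ b),
      fun i => (hk _ ⟨i, rfl⟩).trans (ha i)⟩

/-- Take `r(a,b) = Y`, `r(b,c) = X` and `r(a,c) = R`, a permitted triangle. Over `b` the value R is
the imposed one, while over the empty set independence would require G. -/
theorem not_baseReduction (hM : RealisesTypes M) : ¬ BaseReduction S26 order26 M := by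
  intro h
  obtain ⟨b, -⟩ := hM ∅ Set.finite_empty (fun _ => Hue.G) (by simp) (by simp)
  obtain ⟨c, hc⟩ := hM {b} (Set.finite_singleton b) (fun _ => X) (by simp)
    (by simp [d_self, tri_eq_mid])
  have hcb : d c b = X := hc b rfl
  have hne : c ≠ b := fun h => by rw [h, d_self] at hcb; cases hcb
  classical
  obtain ⟨a, ha⟩ := hM {b, c} (Set.toFinite _) (fun y => if y = b then Y else R)
    (by intro y _; split_ifs <;> decide)
    (by
      rintro _ (rfl | rfl) _ (rfl | rfl)
      · simp [d_self, tri_eq_mid]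
      · rw [if_pos rfl, if_neg hne, d_comm, hcb]; decide
      · rw [if_pos rfl, if_neg hne, hcb]; decide
      · simp [d_self, tri_eq_mid])
  have hab : d a b = Y := by simpa using ha b (by simp)
  have hac : d a c = R := by simpa [hne] using ha c (by simp)
  have h1 : Perp {a} (insert b ∅) {c} := by
    rintro _ rfl _ rfl
    exact Or.inl ⟨b, by simp, by rw [hab, d_comm, hcb, hac]; rfl⟩
  have h2 := indep_iff.1 (h a b c ∅ Set.finite_empty
    ⟨2, (IsColouring.hasColour_iff _ _ _).2 hab⟩ (indep_iff.2 h1))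
  rcases h2 a rfl c rfl with ⟨_, ⟨⟩, _⟩ | ⟨h3, -⟩
  rw [hac] at h3
  cases h3

theorem MovesMaximally.movesAlmostMaximally [ColourHomogeneous (M ≃[L26] M) M] {g : M ≃[L26] M}
    (hg : MovesMaximally M g) : MovesAlmostMaximally (Indep S26 order26) g := by
  intro Z p hZ
  obtain ⟨s, hs, hi⟩ := hg.exists_ind_smul hZ p
  refine ⟨s p, ⟨s, hs, fun i => by fin_cases i; rfl⟩, indep_iff.2 ?_⟩
  rintro _ rfl _ rfl
  exact hi

end Limit

end ColouredTriangles

/-! ### The theorem for an arbitrary Fraïssé limit -/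

theorem mainTheorem4 :
    IsPrioritisedSemiFree.{u} S26 order26 ∧
    (∃ (M : Type u) (_ : L26.Structure M) (_ : Countable M), IsFraisseLimit (Forb.{u} S26) M) ∧
    ∀ (M : Type u) [L26.Structure M] [Countable M], IsFraisseLimit (Forb.{u} S26) M →
      IsStationaryIndependence L26 (M := M) (Indep S26 order26) ∧
      ¬ BaseReduction S26 order26 M ∧
      (∀ g : M ≃[L26] M, g ≠ 1 → ∃ k h : M ≃[L26] M,
        MovesAlmostMaximally (Indep S26 order26) (groupCommutator k (groupCommutator h g))) ∧
      IsSimpleGroup (M ≃[L26] M) := by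
  refine ⟨isPrioritisedSemiFree, ?_, fun M _ _ hM => ?_⟩
  · obtain ⟨U, _, _, hc, _, hU⟩ := exists_countable_realisesTypes.{u}
    exact ⟨U, _, hc, hU.isFraisseLimit⟩
  · obtain ⟨_, _, hM'⟩ := exists_realisesTypes hM
    have := colourHomogeneous_aut hM.ultrahomogeneous hM'
    refine ⟨isStationaryIndependence, not_baseReduction hM', fun g hg => ?_,
      isSimpleGroup_of_homogeneous (M ≃[L26] M) M⟩
    obtain ⟨k, h, hkh⟩ := exists_commutator_movesMaximally (M := M) hg
    exact ⟨k, h, hkh.movesAlmostMaximally⟩
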